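/- Let $K\subset\mathbb R^2$ be a nonempty compact convex set that is not a single point, let $L=|\partial K|$, where $\partial K$ is regarded as a closed convex curve (a segment is run through twice), and put $n_\vartheta=(\cos\vartheta,\sin\vartheta)$, $t_\vartheta=(-\sin\vartheta,\cos\vartheta)$. For $\vartheta\in\mathbb R$ let $F(\vartheta)$ be the set of $x\in\partial K$ with $\langle n_\vartheta,y-x\rangle\le 0$ for all $y\in K$. Let $x_l:\mathbb R\to\partial K$ be the $L$-periodic counterclockwise arc length parametrization of $\partial K$, let $x_0=x_l(s_0)\in\partial K$, and let $x_r(s)=x_l(2s_0-s)$ be the clockwise one; so $x_0=x_r(s_0)$. Assume that $K$ is not a segment having $x_0$ as an endpoint. Let $s_{l+}(\vartheta)$ be the parameter of the last point of $F(\vartheta)$ met by $x_l$, and $s_{r-}(\vartheta)$ the parameter of the last point of $F(\vartheta)$ met by $x_r$, both lifted to monotone functions of $\vartheta\in\mathbb R$ (increasing, respectively decreasing) by means of a nondecreasing choice of the angle of the outer normal along $\partial K$. Put $$\vartheta_0^+=\inf\{\vartheta: s_{l+}(\vartheta)>s_0\},\qquad \vartheta_0^-=\sup\{\vartheta: s_{r-}(\vartheta)>s_0\},$$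 so that $[\vartheta_0^-,\vartheta_0^+]$ is the interval of angles of outer normals at $x_0$ (on the side determined by $s_0$ if $K$ is a segment). The left involute starting at $x_0$ and the right involute ending at $x_0$ are $$i_l(\vartheta)=x_l(s_{l+}(\vartheta))-(s_{l+}(\vartheta)-s_0)\,t_\vartheta\ \ (\vartheta\ge\vartheta_0^+),\qquad i_r(\vartheta)=x_r(s_{r-}(\vartheta))+(s_{r-}(\vartheta)-s_0)\,t_\vartheta\ \ (\vartheta\le\vartheta_0^-).$$ If the tangent cone of $K$ at $x_0$ has opening at most $\pi/2$, put $\vartheta_l^*=\vartheta_0^++3\pi/2$ and $\vartheta_r^*=\vartheta_0^--3\pi/2$. Otherwise let $\vartheta_l^*\in[\vartheta_0^++3\pi/2,\vartheta_0^++2\pi)$ be the angle such that the support line of $K$ with outer normal $n_{\vartheta_l^*}$ is tangent to the left involute at $i_l(\vartheta_l^*-3\pi/2)$, and let $\vartheta_r^*\in(\vartheta_0^--2\pi,\vartheta_0^--3\pi/2]$ be the angle such that the support line with outer normal $n_{\vartheta_r^*}$ is tangent to the right involute at $i_r(\vartheta_r^*+3\pi/2)$. Then $\vartheta_l^*$ and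 $\vartheta_r^*$ exist and are unique, and the arcs $i_l([\vartheta_0^+,\vartheta_0^++2\pi])$ and $i_r([\vartheta_0^--2\pi,\vartheta_0^-])$ have exactly one point $\overline y\ne x_0$ in common. Moreover $\overline y=i_l(\tilde\vartheta_l)=i_r(\tilde\vartheta_r)$ with parameters $\tilde\vartheta_l\in[\vartheta_0^+,\vartheta_0^++2\pi]$, $\tilde\vartheta_r\in[\vartheta_0^--2\pi,\vartheta_0^-]$ satisfying $$\vartheta_0^-\le\vartheta_r^*+2\pi<\tilde\vartheta_r+2\pi<\vartheta_0^++\tfrac{3\pi}2\le\vartheta_l^*,$$ $$\vartheta_r^*\le\vartheta_0^--\tfrac{3\pi}2<\tilde\vartheta_l-2\pi<\vartheta_l^*-2\pi\le\vartheta_0^+,$$ and in particular $\vartheta_r^*+2\pi<\tilde\vartheta_l<\vartheta_l^*$ and $\vartheta_r^*<\tilde\vartheta_r<\vartheta_l^*-2\pi$. -/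

import Mathlib

open Real Set

noncomputable section

/-- The Euclidean plane. -/
abbrev Plane := EuclideanSpace ℝ (Fin 2)

/-- The unit vector `n_ϑ = (cos ϑ, sin ϑ)`. -/
def nvec (ϑ : ℝ) : Plane := !₂[cos ϑ, sin ϑ]

/-- The unit vector `t_ϑ = (-sin ϑ, cos ϑ)`. -/
def tvec (ϑ : ℝ) : Plane := !₂[-sin ϑ, cos ϑ]

/-- The reverse generalized Gauss map `F(n_ϑ)`: the points of `∂K` at which `n_ϑ` is an outer
normal of `K`. -/
def gaussFace (K : Set Plane) (ϑ : ℝ) : Set Plane :=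
  {x | x ∈ frontier K ∧ ∀ y ∈ K, inner ℝ (nvec ϑ) (y - x) ≤ 0}

/-- `xl : ℝ → ∂K` is a counterclockwise arc length parametrization of the closed convex curve `∂K`,
extended periodically with period `L = |∂K|`, and `ω s` is a continuous-from-the-right,
nondecreasing choice of the angle of the outer normal at `xl s`: the unit right tangent vector at
`xl s` is `t_{ω s}`, the normal of the corresponding support line is `n_{ω s}`, and the normal
makes exactly one full turn in each period. (For a segment `K`, the curve `∂K` is the segment
run through once in each direction, and `L` is twice its length.) -/
structure IsCcwArcLengthParam (K : Set Plane) (L : ℝ) (xl : ℝ → Plane) (ω : ℝ → ℝ) : Prop where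
  length_pos : 0 < L
  continuous : Continuous xl
  range_eq : range xl = frontier K
  periodic : ∀ s, xl (s + L) = xl s
  angle_mono : Monotone ω
  angle_rightCont : ∀ s, ContinuousWithinAt ω (Ici s) s
  angle_turn : ∀ s, ω (s + L) = ω s + 2 * π
  mem_face : ∀ s, xl s ∈ gaussFace K (ω s)
  unit_speed : ∀ s, HasDerivWithinAt xl (tvec (ω s)) (Ici s) s

/-- The clockwise arc length parametrization `x_r`, normalized by `x_r s₀ = x_l s₀`. -/
def rightParam (xl : ℝ → Plane) (s₀ s : ℝ) : Plane := xl (2 * s₀ - s)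

/-- `s_{l+}(ϑ)`: the parameter of the last point of `F(n_ϑ)` met by `x_l`, lifted to an increasing
right continuous function of `ϑ ∈ ℝ`. -/
def sLeft (ω : ℝ → ℝ) (ϑ : ℝ) : ℝ := sSup {s | ω s ≤ ϑ}

/-- `s_{r-}(ϑ)`: the parameter of the last point of `F(n_ϑ)` met by the clockwise parametrization
`x_r`, lifted to a decreasing function of `ϑ ∈ ℝ`. It is the mirror image of `s_{l+}`. -/
def sRight (ω : ℝ → ℝ) (s₀ ϑ : ℝ) : ℝ := sSup {s | ϑ ≤ ω (2 * s₀ - s)}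

/-- `ϑ₀⁺ = ϑ_{l+}(s₀)`, where `ϑ_{l+}` is the right continuous inverse of `s_{l+}`. -/
def anglePlus (ω : ℝ → ℝ) (s₀ : ℝ) : ℝ := sInf {ϑ | s₀ < sLeft ω ϑ}

/-- `ϑ₀⁻ = ϑ_{r-}(s₀)`, the mirror image of `ϑ₀⁺`. -/
def angleMinus (ω : ℝ → ℝ) (s₀ : ℝ) : ℝ := sSup {ϑ | s₀ < sRight ω s₀ ϑ}

/-- The left involute of `∂K` starting at `x_l s₀` (used for `ϑ ≥ ϑ₀⁺`). -/
def leftInvolute (xl : ℝ → Plane) (ω : ℝ → ℝ) (s₀ ϑ : ℝ) : Plane :=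
  xl (sLeft ω ϑ) - (sLeft ω ϑ - s₀) • tvec ϑ

/-- The right involute of `∂K` starting at `x_l s₀` (used for `ϑ ≤ ϑ₀⁻`). -/
def rightInvolute (xl : ℝ → Plane) (ω : ℝ → ℝ) (s₀ ϑ : ℝ) : Plane :=
  rightParam xl s₀ (sRight ω s₀ ϑ) + (sRight ω s₀ ϑ - s₀) • tvec ϑ

/-- The tangent cone of `K` at `q`. -/
def tangentSector (K : Set Plane) (q : Plane) : Set Plane :=
  closure (⋃ y ∈ K, {v | ∃ c : ℝ, 0 ≤ c ∧ v = c • (y - q)})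

/-- The tangent cone of `K` at `q` has opening at most `π / 2`. -/
def OpeningLeRight (K : Set Plane) (q : Plane) : Prop :=
  ∀ u ∈ tangentSector K q, ∀ v ∈ tangentSector K q, InnerProductGeometry.angle u v ≤ π / 2

/-- `ϑ = ϑ*_l`. If the tangent cone at `x₀ = x_l s₀` has opening at most `π / 2`, this is
`ϑ₀⁺ + 3π/2`. Otherwise it is the angle in `[ϑ₀⁺ + 3π/2, ϑ₀⁺ + 2π)` such that the line orthogonal
to `n_ϑ` supporting `K` at a point `B ∈ F(n_ϑ)` is tangent to the left involute at
`A = i_l(ϑ - 3π/2)`, i.e. passes through `A`: the tangent direction of the involute at the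
parameter `ϑ - 3π/2` is `n_{ϑ - 3π/2}`, which is orthogonal to `n_ϑ`. -/
def IsThetaStarLeft (K : Set Plane) (xl : ℝ → Plane) (ω : ℝ → ℝ) (s₀ ϑ : ℝ) : Prop :=
  (OpeningLeRight K (xl s₀) ∧ ϑ = anglePlus ω s₀ + 3 * π / 2) ∨
  (¬ OpeningLeRight K (xl s₀) ∧
    anglePlus ω s₀ + 3 * π / 2 ≤ ϑ ∧ ϑ < anglePlus ω s₀ + 2 * π ∧
    ∃ B ∈ gaussFace K ϑ,
      inner ℝ (nvec ϑ) (leftInvolute xl ω s₀ (ϑ - 3 * π / 2) - B) = 0)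

/-- `ϑ = ϑ*_r`, the mirror image of `ϑ*_l`. -/
def IsThetaStarRight (K : Set Plane) (xl : ℝ → Plane) (ω : ℝ → ℝ) (s₀ ϑ : ℝ) : Prop :=
  (OpeningLeRight K (xl s₀) ∧ ϑ = angleMinus ω s₀ - 3 * π / 2) ∨
  (¬ OpeningLeRight K (xl s₀) ∧
    angleMinus ω s₀ - 2 * π < ϑ ∧ ϑ ≤ angleMinus ω s₀ - 3 * π / 2 ∧
    ∃ B ∈ gaussFace K ϑ,
      inner ℝ (nvec ϑ) (rightInvolute xl ω s₀ (ϑ + 3 * π / 2) - B) = 0)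

end

/-!
Put the origin at `x₀`. Let `h` be the support function of `K` as a function of the angle of the
normal, and let `H ϑ` be the arc length from `x₀` to the contact point of angle `ϑ`, less the
component of that point along `t_ϑ`. Then `H' = h`
(`IsCcwArcLengthParam.hasDerivAt_supportPrimitive`), and both involutes are arcs of the single
curve `I = h • n - H • t`, which stays at `x₀` on `[ϑ₀⁻, ϑ₀⁺]`. So the theorem becomes a statement
on the two functions `h` and `H`, whose properties are collected in `SupportData`; these are
invariant under reflection of the plane, which exchanges the two involutes.

For a point `P = I ψ` of the right involute consider `gap φ ψ = ⟨t_φ, P - I φ⟩` as a function of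
`φ`. Its derivative in `φ` is the signed distance from `P` to the support line of angle `φ`, so
`P = I φ` exactly if `gap` has a critical point with value `0` at `φ`. By sublinearity of the support
function, `gap` has one critical value on `(ψ, ψ + π]`, namely its minimum `minGap ψ` over
`[ψ, ψ + π]`, and a full turn of `φ` adds the perimeter `L` to `gap`. Hence the points common to both
arcs, other than `x₀`, are the `I ψ` with `minGap ψ = -k L` for an integer `k`, and only `k = 1`
is possible (`SupportData.minGap_eq_neg_length`).

As `I` moves in the direction `-n_ψ` for `ψ < ϑ₀⁻`, `gap φ ψ` is strictly increasing in `ψ` for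
fixed `φ`, as long as `φ ∈ [ψ, ψ + π]`, and therefore `minGap` is strictly increasing
(`SupportData.strictMonoOn_minGap`). This gives uniqueness, and the intermediate value theorem
gives existence (`SupportData.exists_meet`). The estimates for the parameters follow by comparing
`minGap` with `-L`: it is larger at `ϑ₀⁺ - π/2` (`SupportData.neg_length_lt_minGap`) and smaller
at `ϑ*_r` (`SupportData.minGap_thetaStar_lt`). The angle `ϑ*_r` itself is the solution of
`-H (ϑ + 3π/2) = h ϑ`, in which one side is decreasing and the other nondecreasing
(`SupportData.existsUnique_thetaStar`). The statements on `ϑ*_l` and on the parameter along the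
left involute follow by reflection.
-/

/-! ### Support functions relative to a boundary point -/

/-- The support function `h` of a planar convex body with respect to one of its boundary points,
as a function of the angle of the normal, with its primitive `H`; `[a, b]` is the interval of angles
of normals at that point and `L` is the perimeter. Both involutes from that point are arcs of the
curve `h x • n_x - H x • t_x`. The fields `mono_left` and `mono_right` express, without
derivatives, that with increasing `x` the curve moves in the direction `-n_x` for `x < a` and in the
direction `n_x` for `x > b`. -/
structure SupportData (h H : ℝ → ℝ) (a b L : ℝ) : Prop where
  length_pos : 0 < L
  hasDerivAt : ∀ x, HasDerivAt H (h x) x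
  continuous : Continuous h
  periodic : ∀ x, h (x + 2 * π) = h x
  primitive_turn : ∀ x, H (x + 2 * π) = H x + L
  nonneg : ∀ x, 0 ≤ h x
  sublinear : ∀ ⦃α θ β⦄, α ≤ θ → θ ≤ β → β ≤ α + π →
    h θ * sin (β - α) ≤ h α * sin (β - θ) + h β * sin (θ - α)
  le : a ≤ b
  lt_add_pi : b < a + π
  eq_zero : ∀ x ∈ Icc a b, h x = 0
  primitive_eq_zero : ∀ x ∈ Icc a b, H x = 0
  pos_right : ∀ x, b < x → x < b + π → 0 < h x
  pos_left : ∀ x, a - π < x → x < a → 0 < h x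
  mono_left : ∀ ⦃φ ψ₁ ψ₂⦄, ψ₁ < ψ₂ → ψ₂ < a → ψ₂ ≤ φ → φ ≤ ψ₁ + π →
    H φ - H ψ₁ * cos (φ - ψ₁) - h ψ₁ * sin (φ - ψ₁)
      < H φ - H ψ₂ * cos (φ - ψ₂) - h ψ₂ * sin (φ - ψ₂)
  mono_right : ∀ ⦃ψ φ₁ φ₂⦄, φ₁ < φ₂ → b < φ₁ → ψ ≤ φ₁ → φ₂ ≤ ψ + π →
    H ψ - H φ₁ * cos (ψ - φ₁) - h φ₁ * sin (ψ - φ₁)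
      < H ψ - H φ₂ * cos (ψ - φ₂) - h φ₂ * sin (ψ - φ₂)

/-- The component along `t_φ` of the vector from the point of parameter `φ` to the point `P` of
parameter `ψ` of the curve `h • n - H • t`. -/
noncomputable def gap (h H : ℝ → ℝ) (φ ψ : ℝ) : ℝ := H φ - H ψ * cos (φ - ψ) - h ψ * sin (φ - ψ)

/-- The signed distance from the point of parameter `ψ` of the curve `h • n - H • t` to the support
line with normal `n_φ`: positive on the side of the body. It is the derivative of `gap h H φ ψ` with
respect to `φ`, and the support function of the body with respect to that point. -/
noncomputable def normalGap (h H : ℝ → ℝ) (φ ψ : ℝ) : ℝ :=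
  h φ - h ψ * cos (φ - ψ) + H ψ * sin (φ - ψ)

/-- The minimum of `gap h H φ ψ` over `φ ∈ [ψ, ψ + π]`. -/
noncomputable def minGap (h H : ℝ → ℝ) (ψ : ℝ) : ℝ := sInf ((fun τ => gap h H (ψ + τ) ψ) '' Icc 0 π)

lemma gap_self (h H : ℝ → ℝ) (ψ : ℝ) : gap h H ψ ψ = 0 := by simp [gap]

lemma normalGap_self (h H : ℝ → ℝ) (ψ : ℝ) : normalGap h H ψ ψ = 0 := by simp [normalGap]

lemma gap_add_pi (h H : ℝ → ℝ) (ψ : ℝ) : gap h H (ψ + π) ψ = H ψ + H (ψ + π) := by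
  simp [gap]; ring

lemma gap_reflect (h H : ℝ → ℝ) (φ ψ : ℝ) :
    gap (fun x => h (-x)) (fun x => -H (-x)) φ ψ = -gap h H (-φ) (-ψ) := by
  have e : -φ - -ψ = -(φ - ψ) := by ring
  simp only [gap, e, cos_neg, sin_neg]; ring

namespace SupportData

variable {h H : ℝ → ℝ} {a b L : ℝ}

/-- The data of the body reflected in the first coordinate axis. -/
lemma reflect (D : SupportData h H a b L) :
    SupportData (fun x => h (-x)) (fun x => -H (-x)) (-b) (-a) L where
  length_pos := D.length_pos
  hasDerivAt x := by
    have := ((D.hasDerivAt (-x)).comp x (hasDerivAt_neg x)).neg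
    exact this.congr_deriv (by ring)
  continuous := D.continuous.comp continuous_neg
  periodic x := by
    have := D.periodic (-(x + 2 * π))
    simp only [neg_add_rev] at this ⊢
    rw [← this]; ring_nf
  primitive_turn x := by
    have := D.primitive_turn (-(x + 2 * π))
    have e : -(x + 2 * π) + 2 * π = -x := by ring
    rw [e] at this
    simp only [this]; ring
  nonneg x := D.nonneg _
  sublinear α θ β h1 h2 h3 := by
    have := D.sublinear (α := -β) (θ := -θ) (β := -α) (by linarith) (by linarith) (by linarith)
    simp only [neg_sub_neg] at this ⊢
    linarith
  le := by linarith [D.le]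
  lt_add_pi := by linarith [D.lt_add_pi]
  eq_zero x hx := D.eq_zero _ ⟨by linarith [hx.2], by linarith [hx.1]⟩
  primitive_eq_zero x hx := by
    simp [D.primitive_eq_zero (-x) ⟨by linarith [hx.2], by linarith [hx.1]⟩]
  pos_right x h1 h2 := D.pos_left _ (by linarith) (by linarith)
  pos_left x h1 h2 := D.pos_right _ (by linarith) (by linarith)
  mono_left φ ψ₁ ψ₂ h1 h2 h3 h4 := by
    have := D.mono_right (ψ := -φ) (φ₁ := -ψ₂) (φ₂ := -ψ₁) (by linarith) (by linarith)
      (by linarith) (by linarith)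
    have e1 := gap_reflect h H φ ψ₁
    have e2 := gap_reflect h H φ ψ₂
    simp only [gap] at e1 e2
    linarith
  mono_right ψ φ₁ φ₂ h1 h2 h3 h4 := by
    have := D.mono_left (φ := -ψ) (ψ₁ := -φ₂) (ψ₂ := -φ₁) (by linarith) (by linarith)
      (by linarith) (by linarith)
    have e1 := gap_reflect h H ψ φ₁
    have e2 := gap_reflect h H ψ φ₂
    simp only [gap] at e1 e2
    linarith

lemma differentiable (D : SupportData h H a b L) : Differentiable ℝ H :=
  fun x => (D.hasDerivAt x).differentiableAt

lemma monotone (D : SupportData h H a b L) : Monotone H :=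
  monotone_of_hasDerivAt_nonneg D.hasDerivAt D.nonneg

lemma primitive_lt (D : SupportData h H a b L) {x y : ℝ} (hxy : x < y)
    (hpos : ∀ z ∈ Ioo x y, 0 < h z) : H x < H y := by
  refine strictMonoOn_of_deriv_pos (convex_Icc x y) D.differentiable.continuous.continuousOn ?_
    (left_mem_Icc.2 hxy.le) (right_mem_Icc.2 hxy.le) hxy
  intro z hz
  rw [interior_Icc] at hz
  rw [(D.hasDerivAt z).deriv]
  exact hpos z hz

lemma h_left (D : SupportData h H a b L) : h a = 0 := D.eq_zero a (left_mem_Icc.2 D.le)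
lemma h_right (D : SupportData h H a b L) : h b = 0 := D.eq_zero b (right_mem_Icc.2 D.le)
lemma H_left (D : SupportData h H a b L) : H a = 0 :=
  D.primitive_eq_zero a (left_mem_Icc.2 D.le)
lemma H_right (D : SupportData h H a b L) : H b = 0 :=
  D.primitive_eq_zero b (right_mem_Icc.2 D.le)

lemma H_left_sub (D : SupportData h H a b L) : H (a - 2 * π) = -L := by
  have := D.primitive_turn (a - 2 * π)
  rw [sub_add_cancel, D.H_left] at this
  linarith

lemma h_left_sub (D : SupportData h H a b L) : h (a - 2 * π) = 0 := by
  have := D.periodic (a - 2 * π)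
  rw [sub_add_cancel, D.h_left] at this
  linarith

lemma primitive_neg (D : SupportData h H a b L) {x : ℝ} (hx : x < a) : H x < 0 := by
  have hπ := pi_pos
  have h1 : H x ≤ H (max x (a - π / 2)) := D.monotone (le_max_left _ _)
  have h2 : H (max x (a - π / 2)) < H a := by
    refine D.primitive_lt (max_lt hx (by linarith)) fun z hz => D.pos_left z ?_ hz.2
    linarith [hz.1, le_max_right x (a - π / 2)]
  linarith [D.H_left]

lemma primitive_left_add_pi_pos (D : SupportData h H a b L) : 0 < H (a + π) := by
  rw [← D.H_right]
  exact D.primitive_lt D.lt_add_pi fun z hz => D.pos_right z hz.1 (by linarith [hz.2, D.le])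

/-- The width `h x + h (x + π)` vanishes at most when `x - a` is a multiple of `π`. -/
lemma width_pos (D : SupportData h H a b L) {x : ℝ} (hx : sin (x - a) ≠ 0) :
    0 < h x + h (x + π) := by
  have hπ := pi_pos
  obtain ⟨y, hy, k, rfl⟩ : ∃ y ∈ Ioc (a - π) (a + π), ∃ k : ℤ, x = y + k * (2 * π) := by
    have := toIocMod_mem_Ioc two_pi_pos (a - π) x
    refine ⟨toIocMod two_pi_pos (a - π) x, ⟨this.1, by linarith [this.2]⟩,
      toIocDiv two_pi_pos (a - π) x, ?_⟩
    have := toIocMod_add_toIocDiv_zsmul two_pi_pos (a - π) x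
    rw [zsmul_eq_mul] at this
    exact this.symm
  have hper : Function.Periodic h (2 * π) := D.periodic
  have e1 : h (y + k * (2 * π)) = h y := (hper.int_mul k) y
  have e2 : h (y + k * (2 * π) + π) = h (y + π) := by
    rw [add_right_comm]; exact (hper.int_mul k) (y + π)
  rw [e1, e2]
  have e3 : sin (y - a) ≠ 0 := by
    have e4 : y + k * (2 * π) - a = (y - a) + k * (2 * π) := by ring
    rwa [e4, sin_add_int_mul_two_pi] at hx
  have n1 := D.nonneg y
  have n2 := D.nonneg (y + π)
  rcases lt_trichotomy y a with h1 | h1 | h1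
  · linarith [D.pos_left y hy.1 h1]
  · simp [h1] at e3
  · have hy2 : y < a + π := by
      refine lt_of_le_of_ne hy.2 ?_
      rintro rfl
      simp at e3
    rcases le_or_gt y b with h2 | h2
    · have : 0 < h (y + π - 2 * π) := D.pos_left _ (by linarith) (by linarith)
      rw [← D.periodic, sub_add_cancel] at this
      linarith
    · linarith [D.pos_right y h2 (by linarith [D.le])]

/-- Strict although the width of a segment vanishes in one direction. -/
lemma strictMono_primitive_add (D : SupportData h H a b L) :
    StrictMono fun x => H x + H (x + π) := by
  have hd : ∀ x, HasDerivAt (fun x => H x + H (x + π)) (h x + h (x + π)) x := fun x =>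
    (D.hasDerivAt x).add ((D.hasDerivAt (x + π)).comp_add_const x π)
  have hm : Monotone fun x => H x + H (x + π) :=
    monotone_of_hasDerivAt_nonneg hd fun x => add_nonneg (D.nonneg _) (D.nonneg _)
  intro x y hxy
  refine lt_of_le_of_ne (hm hxy.le) fun heq => ?_
  have hsin : ∀ z ∈ Ioo x y, sin (z - a) = 0 := by
    intro z hz
    by_contra hne
    have hconst : (fun x => H x + H (x + π)) =ᶠ[nhds z] fun _ => H x + H (x + π) := by
      filter_upwards [Ioo_mem_nhds hz.1 hz.2] with w hw
      have h1 := hm hw.1.le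
      have h2 := hm hw.2.le
      simp only at h1 h2 heq ⊢
      linarith
    have h0 := (hd z).unique ((hasDerivAt_const z (H x + H (x + π))).congr_of_eventuallyEq hconst)
    linarith [D.width_pos hne]
  have hmid : (x + y) / 2 ∈ Ioo x y := ⟨by linarith, by linarith⟩
  have hder : HasDerivAt (fun z => sin (z - a)) (cos ((x + y) / 2 - a)) ((x + y) / 2) := by
    simpa using ((hasDerivAt_id ((x + y) / 2)).sub_const a).sin
  have hzero : (fun z => sin (z - a)) =ᶠ[nhds ((x + y) / 2)] fun _ => 0 := by
    filter_upwards [Ioo_mem_nhds hmid.1 hmid.2] with w hw using hsin w hw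
  have h0 := hder.unique ((hasDerivAt_const _ (0 : ℝ)).congr_of_eventuallyEq hzero)
  have := sin_sq_add_cos_sq ((x + y) / 2 - a)
  rw [h0, hsin _ hmid] at this
  norm_num at this

lemma hasDerivAt_gap (D : SupportData h H a b L) (φ ψ : ℝ) :
    HasDerivAt (fun φ => gap h H φ ψ) (normalGap h H φ ψ) φ := by
  have hs : HasDerivAt (fun x => x - ψ) 1 φ := (hasDerivAt_id φ).sub_const ψ
  have := ((D.hasDerivAt φ).sub (hs.cos.const_mul (H ψ))).sub (hs.sin.const_mul (h ψ))
  refine this.congr_deriv ?_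
  simp only [normalGap]; ring

lemma gap_add_int (D : SupportData h H a b L) (φ ψ : ℝ) (k : ℤ) :
    gap h H (φ + k * (2 * π)) ψ = gap h H φ ψ + k * L := by
  have hk : H (φ + k * (2 * π)) = H φ + k * L := by
    induction k using Int.induction_on with
    | zero => simp
    | succ n ih =>
      have := D.primitive_turn (φ + (n : ℤ) * (2 * π))
      rw [ih] at this
      push_cast at this ⊢
      rw [show φ + (n + 1) * (2 * π) = φ + n * (2 * π) + 2 * π by ring, this]; ring
    | pred n ih =>
      have := D.primitive_turn (φ + ((-n - 1 : ℤ) : ℝ) * (2 * π))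
      rw [show φ + ((-n - 1 : ℤ) : ℝ) * (2 * π) + 2 * π = φ + ((-n : ℤ) : ℝ) * (2 * π) by
        push_cast; ring, ih] at this
      push_cast at this ⊢
      linarith
  have e : φ + k * (2 * π) - ψ = (φ - ψ) + k * (2 * π) := by ring
  simp only [gap, hk, e, cos_add_int_mul_two_pi, sin_add_int_mul_two_pi]
  ring

lemma normalGap_add_int (D : SupportData h H a b L) (φ ψ : ℝ) (k : ℤ) :
    normalGap h H (φ + k * (2 * π)) ψ = normalGap h H φ ψ := by
  have hper : Function.Periodic h (2 * π) := D.periodic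
  have hk : h (φ + k * (2 * π)) = h φ := (hper.int_mul k) φ
  have e : φ + k * (2 * π) - ψ = (φ - ψ) + k * (2 * π) := by ring
  simp only [normalGap, hk, e, cos_add_int_mul_two_pi, sin_add_int_mul_two_pi]

lemma normalGap_sublinear (D : SupportData h H a b L) (ψ : ℝ) {α θ β : ℝ} (h1 : α ≤ θ)
    (h2 : θ ≤ β) (h3 : β ≤ α + π) :
    normalGap h H θ ψ * sin (β - α)
      ≤ normalGap h H α ψ * sin (β - θ) + normalGap h H β ψ * sin (θ - α) := by
  have key := D.sublinear h1 h2 h3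
  have ec : cos (θ - ψ) * sin (β - α)
      = cos (α - ψ) * sin (β - θ) + cos (β - ψ) * sin (θ - α) := by
    simp only [cos_sub, sin_sub]; ring
  have es : sin (θ - ψ) * sin (β - α)
      = sin (α - ψ) * sin (β - θ) + sin (β - ψ) * sin (θ - α) := by
    simp only [sin_sub]; ring
  simp only [normalGap]
  linear_combination key - h ψ * ec + H ψ * es

lemma continuous_gap (D : SupportData h H a b L) :
    Continuous (Function.uncurry fun ψ τ : ℝ => gap h H (ψ + τ) ψ) := by
  have := D.differentiable.continuous
  have := D.continuous
  simp only [gap, Function.uncurry_def]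
  fun_prop

lemma exists_minGap (D : SupportData h H a b L) (ψ : ℝ) :
    ∃ φ ∈ Icc ψ (ψ + π), minGap h H ψ = gap h H φ ψ ∧
      ∀ φ' ∈ Icc ψ (ψ + π), gap h H φ ψ ≤ gap h H φ' ψ := by
  have hc : Continuous fun τ : ℝ => gap h H (ψ + τ) ψ :=
    D.continuous_gap.comp (Continuous.prodMk_right ψ)
  obtain ⟨τ, hτ, he, hmin⟩ := isCompact_Icc.exists_sInf_image_eq_and_le
    (nonempty_Icc.2 pi_pos.le) hc.continuousOn
  refine ⟨ψ + τ, ⟨by linarith [hτ.1], by linarith [hτ.2]⟩, he, fun φ' hφ' => ?_⟩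
  have := hmin (φ' - ψ) ⟨by linarith [hφ'.1], by linarith [hφ'.2]⟩
  simpa using this

lemma minGap_le (D : SupportData h H a b L) {φ ψ : ℝ} (h1 : ψ ≤ φ) (h2 : φ ≤ ψ + π) :
    minGap h H ψ ≤ gap h H φ ψ := by
  obtain ⟨φ', -, he, hmin⟩ := D.exists_minGap ψ
  rw [he]
  exact hmin φ ⟨h1, h2⟩

lemma continuous_minGap (D : SupportData h H a b L) : Continuous (minGap h H) :=
  isCompact_Icc.continuous_sInf D.continuous_gap

lemma gap_lt_gap (D : SupportData h H a b L) {φ ψ₁ ψ₂ : ℝ} (h1 : ψ₁ < ψ₂) (h2 : ψ₂ < a)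
    (h3 : ψ₂ ≤ φ) (h4 : φ ≤ ψ₁ + π) : gap h H φ ψ₁ < gap h H φ ψ₂ :=
  D.mono_left h1 h2 h3 h4

lemma minGap_neg (D : SupportData h H a b L) {ψ : ℝ} (hψ : ψ < a) : minGap h H ψ < 0 := by
  rcases le_or_gt (a - π) ψ with h1 | h1
  · refine (D.minGap_le hψ.le (by linarith)).trans_lt ?_
    have hmid : gap h H a ψ < gap h H a ((ψ + a) / 2) :=
      D.gap_lt_gap (by linarith) (by linarith) (by linarith) (by linarith)
    have hlim : Filter.Tendsto (fun x => gap h H a x) (nhdsWithin a (Iio a)) (nhds 0) := by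
      have hc : Continuous fun x => gap h H a x := by
        have := D.differentiable.continuous
        have := D.continuous
        simp only [gap]
        fun_prop
      have := hc.tendsto a
      rw [gap_self] at this
      exact this.mono_left nhdsWithin_le_nhds
    refine hmid.trans_le (ge_of_tendsto hlim ?_)
    filter_upwards [Ioo_mem_nhdsLT (show (ψ + a) / 2 < a by linarith)] with x hx
    exact (D.gap_lt_gap hx.1 hx.2 hx.2.le (by linarith)).le
  · refine (D.minGap_le (φ := ψ + π) (by linarith [pi_pos]) le_rfl).trans_lt ?_
    rw [gap_add_pi]
    linarith [D.primitive_neg hψ, D.primitive_neg (show ψ + π < a by linarith)]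

/-- The decrease of `minGap` to the left is local: a minimizer for `ψ` still lies in the
window of slightly smaller parameters, unless it is `ψ + π`, where `gap` is explicit. -/
lemma minGap_lt_near (D : SupportData h H a b L) {ψ : ℝ} (hψ : ψ < a) :
    ∃ c < ψ, ∀ x, c ≤ x → x < ψ → minGap h H x < minGap h H ψ := by
  obtain ⟨φ, hφ, he, -⟩ := D.exists_minGap ψ
  rcases hφ.2.lt_or_eq with h1 | h1
  · refine ⟨φ - π, by linarith, fun x hcx hx => ?_⟩
    rw [he]
    exact (D.minGap_le (by linarith [hφ.1]) (by linarith)).trans_lt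
      (D.gap_lt_gap hx hψ hφ.1 (by linarith))
  · refine ⟨ψ - 1, by linarith, fun x _ hx => ?_⟩
    rw [he, h1, gap_add_pi]
    refine (D.minGap_le (φ := x + π) (by linarith [pi_pos]) le_rfl).trans_lt ?_
    rw [gap_add_pi]
    exact D.strictMono_primitive_add hx

lemma strictMonoOn_minGap (D : SupportData h H a b L) : StrictMonoOn (minGap h H) (Iio a) := by
  intro x hx y hy hxy
  obtain ⟨z, hz, hmin⟩ := isCompact_Icc.exists_isMinOn (nonempty_Icc.2 hxy.le)
    D.continuous_minGap.continuousOn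
  -- a minimum point of `minGap` on `[x, y]` can only be `x`
  have key : ∀ w ∈ Icc x y, minGap h H w = minGap h H z → w = x := by
    intro w hw hwz
    by_contra hne
    have hxw : x < w := lt_of_le_of_ne hw.1 (Ne.symm hne)
    obtain ⟨c, hc, hlt⟩ := D.minGap_lt_near (lt_of_le_of_lt hw.2 hy)
    have h1 := hlt (max c x) (le_max_left _ _) (max_lt hc hxw)
    have h2 : minGap h H z ≤ minGap h H (max c x) := hmin (show max c x ∈ Icc x y from
      ⟨le_max_right _ _, (max_lt hc hxw).le.trans hw.2⟩)
    linarith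
  have hzx := key z hz rfl
  subst hzx
  refine lt_of_le_of_ne (hmin (right_mem_Icc.2 hxy.le)) fun heq => ?_
  have := key y (right_mem_Icc.2 hxy.le) heq.symm
  linarith

/-- Since `gap` starts with the value `0` at `ψ` and has a negative minimum, `normalGap` is
somewhere negative, and by sublinearity it is negative from `ψ` up to there. -/
lemma exists_normalGap_neg (D : SupportData h H a b L) {ψ : ℝ} (hψ : ψ < a) :
    ∃ θ ∈ Ioo ψ (ψ + π), ∀ x ∈ Ioc ψ θ, normalGap h H x ψ < 0 := by
  obtain ⟨φ, hφ, he, -⟩ := D.exists_minGap ψ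
  have hneg := D.minGap_neg hψ
  rw [he] at hneg
  have hlt : ψ < φ := by
    refine lt_of_le_of_ne hφ.1 ?_
    rintro rfl
    rw [gap_self] at hneg
    exact lt_irrefl _ hneg
  obtain ⟨θ, hθ, hs⟩ := exists_hasDerivAt_eq_slope (fun φ => gap h H φ ψ)
    (fun φ => normalGap h H φ ψ) hlt
    (fun x _ => (D.hasDerivAt_gap x ψ).continuousAt.continuousWithinAt)
    (fun x _ => D.hasDerivAt_gap x ψ)
  have hθneg : normalGap h H θ ψ < 0 := by
    rw [hs, gap_self]
    exact div_neg_of_neg_of_pos (by linarith) (by linarith)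
  have hθ2 : θ < ψ + π := hθ.2.trans_le hφ.2
  refine ⟨θ, ⟨hθ.1, hθ2⟩, fun x hx => ?_⟩
  have hsub := D.normalGap_sublinear ψ hx.1.le hx.2 hθ2.le
  rw [normalGap_self, zero_mul, zero_add] at hsub
  have s1 : 0 < sin (θ - ψ) := sin_pos_of_pos_of_lt_pi (by linarith [hθ.1]) (by linarith)
  have s2 : 0 < sin (x - ψ) := sin_pos_of_pos_of_lt_pi (by linarith [hx.1]) (by linarith [hx.2])
  by_contra hcon
  push Not at hcon
  nlinarith [mul_nonneg hcon s1.le, mul_neg_of_neg_of_pos hθneg s2]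

/-- A zero `φ` of `normalGap` in `(ψ, ψ + π]` minimizes `gap` on `[ψ, ψ + π]`, as by sublinearity
`normalGap` is nonpositive before `φ` and nonnegative after it. -/
lemma minGap_eq (D : SupportData h H a b L) {φ ψ : ℝ} (hψ : ψ < a) (hφ : φ ∈ Ioc ψ (ψ + π))
    (h0 : normalGap h H φ ψ = 0) : minGap h H ψ = gap h H φ ψ := by
  obtain ⟨θ, hθ, hneg⟩ := D.exists_normalGap_neg hψ
  have hbefore : ∀ x ∈ Ioo ψ φ, normalGap h H x ψ ≤ 0 := by
    intro x hx
    rcases hφ.2.lt_or_eq with h1 | h1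
    · have hsub := D.normalGap_sublinear ψ hx.1.le hx.2.le h1.le
      rw [normalGap_self, h0, zero_mul, zero_mul, zero_add] at hsub
      have s1 : 0 < sin (φ - ψ) := sin_pos_of_pos_of_lt_pi (by linarith [hφ.1]) (by linarith)
      exact nonpos_of_mul_nonpos_left hsub s1
    · rcases le_or_gt x θ with h2 | h2
      · exact (hneg x ⟨hx.1, h2⟩).le
      · have hsub := D.normalGap_sublinear ψ h2.le hx.2.le (by linarith [hθ.1])
        rw [h0, zero_mul, add_zero] at hsub
        have s1 : 0 < sin (φ - θ) :=
          sin_pos_of_pos_of_lt_pi (by linarith [hx.2]) (by linarith [hθ.1])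
        have s2 : 0 < sin (φ - x) :=
          sin_pos_of_pos_of_lt_pi (by linarith [hx.2]) (by linarith [hx.1])
        have := mul_neg_of_neg_of_pos (hneg θ ⟨hθ.1, le_rfl⟩) s2
        exact nonpos_of_mul_nonpos_left (hsub.trans this.le) s1
  have hafter : ∀ x ∈ Ioo φ (ψ + π), 0 ≤ normalGap h H x ψ := by
    intro x hx
    have hsub := D.normalGap_sublinear ψ hφ.1.le hx.1.le hx.2.le
    rw [normalGap_self, h0, zero_mul, zero_mul, zero_add] at hsub
    have s1 : 0 < sin (φ - ψ) :=
      sin_pos_of_pos_of_lt_pi (by linarith [hφ.1]) (by linarith [hx.1, hx.2])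
    exact nonneg_of_mul_nonneg_left hsub s1
  have hcont : Continuous fun φ => gap h H φ ψ :=
    continuous_iff_continuousAt.2 fun x => (D.hasDerivAt_gap x ψ).continuousAt
  have hanti : AntitoneOn (fun φ => gap h H φ ψ) (Icc ψ φ) := by
    refine antitoneOn_of_deriv_nonpos (convex_Icc _ _) hcont.continuousOn
      (fun x _ => (D.hasDerivAt_gap x ψ).differentiableAt.differentiableWithinAt) fun x hx => ?_
    rw [interior_Icc] at hx
    rw [(D.hasDerivAt_gap x ψ).deriv]
    exact hbefore x hx
  have hmono : MonotoneOn (fun φ => gap h H φ ψ) (Icc φ (ψ + π)) := by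
    refine monotoneOn_of_deriv_nonneg (convex_Icc _ _) hcont.continuousOn
      (fun x _ => (D.hasDerivAt_gap x ψ).differentiableAt.differentiableWithinAt) fun x hx => ?_
    rw [interior_Icc] at hx
    rw [(D.hasDerivAt_gap x ψ).deriv]
    exact hafter x hx
  obtain ⟨φ', hφ', he, -⟩ := D.exists_minGap ψ
  refine le_antisymm (D.minGap_le hφ.1.le hφ.2) ?_
  rw [he]
  rcases le_total φ' φ with h1 | h1
  · exact hanti ⟨hφ'.1, h1⟩ ⟨hφ.1.le, le_rfl⟩ h1
  · exact hmono ⟨le_rfl, hφ.2⟩ ⟨h1, hφ'.2⟩ h1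

/-- After a full turn of the right involute, the minimal gap still exceeds `-2L`. -/
lemma minGap_turn (D : SupportData h H a b L) : -(2 * L) < minGap h H (a - 2 * π) := by
  obtain ⟨φ, hφ, he, -⟩ := D.exists_minGap (a - 2 * π)
  have hL := D.length_pos
  rw [he, gap, D.H_left_sub, D.h_left_sub]
  have hmono := D.monotone hφ.1
  rw [D.H_left_sub] at hmono
  rcases hφ.2.lt_or_eq with h1 | h1
  · have : cos π < cos (φ - (a - 2 * π)) :=
      cos_lt_cos_of_nonneg_of_le_pi (by linarith [hφ.1]) le_rfl (by linarith)
    rw [cos_pi] at this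
    nlinarith
  · have h2 := D.primitive_turn φ
    have h3 := D.primitive_left_add_pi_pos
    rw [show φ + 2 * π = a + π by linarith] at h2
    have := neg_one_le_cos (φ - (a - 2 * π))
    nlinarith

/-- If the points of parameters `ψ < a` and `φ ≥ b` of the curve coincide, then a translate
`φ - 2πk` minimizes `gap`, with minimum `-kL`; the bounds `minGap_neg` and `minGap_turn` leave
only `k = 1`. -/
lemma minGap_eq_neg_length (D : SupportData h H a b L) {φ ψ : ℝ} (h1 : a - 2 * π ≤ ψ)
    (hψ : ψ < a) (hφ : b ≤ φ) (h0 : normalGap h H φ ψ = 0) (hg : gap h H φ ψ = 0) :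
    minGap h H ψ = -L := by
  have hL := D.length_pos
  set x := toIocMod two_pi_pos ψ φ with hx
  set k := toIocDiv two_pi_pos ψ φ with hk
  have hmem : x ∈ Ioc ψ (ψ + 2 * π) := toIocMod_mem_Ioc two_pi_pos ψ φ
  have hφx : φ = x + k * (2 * π) := by
    have := toIocMod_add_toIocDiv_zsmul two_pi_pos ψ φ
    rw [zsmul_eq_mul] at this
    exact this.symm
  rw [hφx, D.normalGap_add_int] at h0
  rw [hφx, D.gap_add_int] at hg
  have hxπ : x ≤ ψ + π := by
    by_contra hcon
    push Not at hcon
    rcases hmem.2.lt_or_eq with h2 | h2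
    · -- `normalGap` would vanish at `x - 2π` and at `ψ`, so it could not be negative after `ψ`
      obtain ⟨θ, hθ, hneg⟩ := D.exists_normalGap_neg hψ
      have e : normalGap h H (x - 2 * π) ψ = 0 := by
        have := D.normalGap_add_int x ψ (-1)
        rw [h0] at this
        rw [← this]; congr 1; push_cast; ring
      have hm1 : ψ < min θ (x - π) := lt_min hθ.1 (by linarith)
      have hsub := D.normalGap_sublinear ψ (α := x - 2 * π) (θ := ψ) (β := min θ (x - π))
        (by linarith) hm1.le (by linarith [min_le_right θ (x - π)])
      rw [normalGap_self, e, zero_mul, zero_mul, zero_add] at hsub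
      have s1 : 0 < sin (ψ - (x - 2 * π)) :=
        sin_pos_of_pos_of_lt_pi (by linarith) (by linarith)
      have := mul_neg_of_neg_of_pos (hneg _ ⟨hm1, min_le_left _ _⟩) s1
      linarith
    · have e := D.gap_add_int ψ ψ 1
      rw [gap_self] at e
      push_cast at e
      rw [one_mul, ← h2] at e
      rw [e] at hg
      have hk1 : (k : ℝ) = -1 := by
        have : ((k : ℝ) + 1) * L = 0 := by linarith
        rcases mul_eq_zero.1 this with h3 | h3 <;> linarith
      rw [hk1] at hφx
      linarith [D.le]
  have hmin := D.minGap_eq hψ ⟨hmem.1, hxπ⟩ h0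
  have hneg := D.minGap_neg hψ
  have hge : minGap h H (a - 2 * π) ≤ minGap h H ψ :=
    D.strictMonoOn_minGap.monotoneOn (show a - 2 * π < a by linarith [pi_pos]) hψ h1
  have hturn := D.minGap_turn
  have hval : minGap h H ψ = -(k * L) := by linarith
  have hk1 : (0 : ℝ) < k := by
    by_contra hcon
    push Not at hcon
    nlinarith
  have hk2 : (k : ℝ) < 2 := by
    by_contra hcon
    push Not at hcon
    nlinarith
  have : k = 1 := by
    have a1 : 0 < k := by exact_mod_cast hk1
    have a2 : k < 2 := by exact_mod_cast hk2
    omega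
  rw [hval, this]; push_cast; ring

/-- The intermediate value theorem gives a point common to both arcs: `minGap` is less than `-L`
after a full turn of the right involute. -/
lemma exists_meet (D : SupportData h H a b L) :
    ∃ ψ ∈ Ioo (a - 2 * π) a, ∃ φ, φ - 2 * π ∈ Ioc ψ (ψ + π) ∧
      normalGap h H φ ψ = 0 ∧ gap h H φ ψ = 0 := by
  have hL := D.length_pos
  have hπ := pi_pos
  have hlow : minGap h H (a - 2 * π) < -L := by
    refine (D.minGap_le (φ := a - 2 * π + π) (by linarith) le_rfl).trans_lt ?_
    rw [gap_add_pi, D.H_left_sub]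
    linarith [D.primitive_neg (show a - 2 * π + π < a by linarith)]
  have hhigh : -L < minGap h H a := by
    obtain ⟨φ, hφ, he, -⟩ := D.exists_minGap a
    have := D.monotone hφ.1
    rw [D.H_left] at this
    rw [he, gap, D.H_left, D.h_left]
    linarith
  obtain ⟨ψ, hψ, hval⟩ := intermediate_value_Ioo (show a - 2 * π ≤ a by linarith)
    D.continuous_minGap.continuousOn ⟨hlow, hhigh⟩
  obtain ⟨φ, hφ, he, hmin⟩ := D.exists_minGap ψ
  rw [hval] at he
  have hlt : ψ < φ := by
    refine lt_of_le_of_ne hφ.1 ?_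
    rintro rfl
    rw [gap_self] at he
    linarith
  have hn : normalGap h H φ ψ = 0 := by
    rcases hφ.2.lt_or_eq with h1 | h1
    · refine IsLocalMin.hasDerivAt_eq_zero ?_ (D.hasDerivAt_gap φ ψ)
      filter_upwards [Ioo_mem_nhds hlt h1] with x hx using hmin x ⟨hx.1.le, hx.2.le⟩
    · refine le_antisymm ?_ ?_
      · by_contra hcon
        push Not at hcon
        have hev : ∀ᶠ x in nhdsWithin φ (Iio φ), gap h H x ψ < gap h H φ ψ := by
          have h2 := (hasDerivWithinAt_iff_tendsto_slope' (s := Iio φ) (by simp)).1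
            ((D.hasDerivAt_gap φ ψ).hasDerivWithinAt (s := Iio φ))
          filter_upwards [h2.eventually (lt_mem_nhds hcon), self_mem_nhdsWithin] with x hx hx2
          rw [slope_def_field] at hx
          have hx3 : x - φ < 0 := sub_neg.2 hx2
          have := (div_pos_iff.1 hx).resolve_left fun hh => by linarith [hh.2]
          linarith [this.1]
        obtain ⟨x, hx, hx2⟩ := (hev.and (Ioo_mem_nhdsLT hlt)).exists
        linarith [hmin x ⟨hx2.1.le, hx2.2.le.trans hφ.2⟩]
      · have hsum : normalGap h H φ ψ = h (ψ + π) + h ψ := by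
          rw [h1]; simp [normalGap]
        rw [hsum]
        exact add_nonneg (D.nonneg _) (D.nonneg _)
  refine ⟨ψ, hψ, φ + 2 * π, ⟨by linarith, by linarith [hφ.2]⟩, ?_, ?_⟩
  · have := D.normalGap_add_int φ ψ 1
    push_cast at this
    rw [one_mul] at this
    rw [this, hn]
  · have := D.gap_add_int φ ψ 1
    push_cast at this
    rw [one_mul, one_mul] at this
    rw [this]; linarith

/-- The perimeter is at least twice the distance of the base point from any support line. -/
lemma two_mul_le_length (D : SupportData h H a b L) (c : ℝ) : 2 * h c ≤ L := by
  have hπ := pi_pos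
  have hd : ∀ x, HasDerivAt (fun x => H (c + x) - H (c - x) - 2 * h c * sin x)
      (h (c + x) + h (c - x) - 2 * h c * cos x) x := fun x => by
    have := (((D.hasDerivAt (c + x)).comp_const_add c x).sub
      ((D.hasDerivAt (c - x)).comp_const_sub c x)).sub ((hasDerivAt_sin x).const_mul (2 * h c))
    refine this.congr_deriv ?_
    ring
  have hm : MonotoneOn (fun x => H (c + x) - H (c - x) - 2 * h c * sin x) (Icc 0 (π / 2)) := by
    refine monotoneOn_of_deriv_nonneg (convex_Icc _ _)
      (fun x _ => (hd x).continuousAt.continuousWithinAt)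
      (fun x _ => (hd x).differentiableAt.differentiableWithinAt) fun x hx => ?_
    rw [interior_Icc] at hx
    rw [(hd x).deriv]
    have hsub := D.sublinear (α := c - x) (θ := c) (β := c + x) (by linarith [hx.1])
      (by linarith [hx.1]) (by linarith [hx.2])
    rw [show c + x - (c - x) = 2 * x by ring, add_sub_cancel_left, sub_sub_cancel,
      sin_two_mul] at hsub
    have s1 : 0 < sin x := sin_pos_of_pos_of_lt_pi hx.1 (by linarith [hx.2])
    have : (h c * (2 * cos x)) * sin x ≤ (h (c - x) + h (c + x)) * sin x := by linarith
    linarith [le_of_mul_le_mul_right this s1]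
  have := hm (left_mem_Icc.2 (by linarith)) (right_mem_Icc.2 (by linarith)) (by linarith)
  simp only [add_zero, sub_zero, sub_self, sin_zero, mul_zero, sin_pi_div_two, mul_one] at this
  have h1 := D.monotone (show c + π / 2 ≤ c - π + 2 * π by linarith)
  have h2 := D.monotone (show c - π ≤ c - π / 2 by linarith)
  rw [D.primitive_turn] at h1
  linarith

/-- For `ψ = b - π / 2` the strings are too short: the minimal gap exceeds `-L`. -/
lemma neg_length_lt_minGap (D : SupportData h H a b L) : -L < minGap h H (b - π / 2) := by
  have hπ := pi_pos
  have hL := D.length_pos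
  set c := b - π / 2 with hc
  have hLc := D.two_mul_le_length c
  have hc0 := D.nonneg c
  have hd : ∀ x, HasDerivAt (fun x => H x + h c * (1 - cos (b - x)))
      (h x - h c * sin (b - x)) x := fun x => by
    have h1 : HasDerivAt (fun x => b - x) (-1) x := (hasDerivAt_id x).const_sub b
    refine ((D.hasDerivAt x).add ((h1.cos.const_sub 1).const_mul (h c))).congr_deriv ?_
    ring
  have hanti : AntitoneOn (fun x => H x + h c * (1 - cos (b - x))) (Icc c b) := by
    refine antitoneOn_of_deriv_nonpos (convex_Icc _ _)
      (fun x _ => (hd x).continuousAt.continuousWithinAt)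
      (fun x _ => (hd x).differentiableAt.differentiableWithinAt) fun x hx => ?_
    rw [interior_Icc] at hx
    rw [(hd x).deriv]
    have hsub := D.sublinear hx.1.le hx.2.le (by linarith)
    rw [show b - c = π / 2 by linarith, sin_pi_div_two, D.h_right] at hsub
    linarith
  have hbound : ∀ x ∈ Icc c b, -(h c * (1 - cos (b - x))) ≤ H x := by
    intro x hx
    have := hanti hx (right_mem_Icc.2 (by linarith)) hx.2
    simp only [sub_self, cos_zero, mul_zero, add_zero, D.H_right] at this
    linarith
  have hHc : H c ≤ 0 := by
    rw [← D.H_right]; exact D.monotone (by linarith)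
  have hHc2 : -(h c) ≤ H c := by
    have := hbound c (left_mem_Icc.2 (by linarith))
    rw [show b - c = π / 2 by linarith, cos_pi_div_two] at this
    linarith
  obtain ⟨φ, hφ, he, -⟩ := D.exists_minGap c
  rw [he, gap]
  rcases le_total φ b with h1 | h1
  · have h2 := hbound φ ⟨hφ.1, h1⟩
    rw [show b - φ = π / 2 - (φ - c) by linarith, cos_pi_div_two_sub] at h2
    have hcos : 0 ≤ cos (φ - c) := cos_nonneg_of_mem_Icc ⟨by linarith [hφ.1], by linarith⟩
    nlinarith [mul_nonneg (neg_nonneg.2 hHc) hcos]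
  · have h2 : 0 ≤ H φ := by rw [← D.H_right]; exact D.monotone h1
    have hcos : cos (φ - c) ≤ 0 :=
      cos_nonpos_of_pi_div_two_le_of_le (by linarith) (by linarith [hφ.2])
    have hcs := sin_sq_add_cos_sq (φ - c)
    -- `√2` is the sharp bound; any bound below `2` suffices, as `2 * h c ≤ L`
    have hsum : sin (φ - c) - cos (φ - c) ≤ 3 / 2 := by
      nlinarith [sq_nonneg (sin (φ - c) + cos (φ - c))]
    have h3 : -(H c * cos (φ - c)) ≥ h c * cos (φ - c) := by nlinarith
    nlinarith [mul_le_mul_of_nonneg_left hsum hc0]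

lemma monotoneOn_near (D : SupportData h H a b L) : MonotoneOn h (Icc a (a + π / 2)) := by
  intro x hx y hy hxy
  rcases hy.1.lt_or_eq with h1 | h1
  · have hsub := D.sublinear hx.1 hxy (by linarith [hy.2, pi_pos])
    rw [D.h_left, zero_mul, zero_add] at hsub
    have s1 : 0 < sin (y - a) :=
      sin_pos_of_pos_of_lt_pi (by linarith) (by linarith [hy.2, pi_pos])
    have s2 : sin (x - a) ≤ sin (y - a) :=
      sin_le_sin_of_le_of_le_pi_div_two (by linarith [hx.1, pi_pos]) (by linarith [hy.2])
        (by linarith)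
    exact le_of_mul_le_mul_right
      (hsub.trans (mul_le_mul_of_nonneg_left s2 (D.nonneg y))) s1
  · have : x = y := le_antisymm hxy (by linarith [hx.1])
    rw [this]

/-- Existence and uniqueness of the angle `ϑ*_r`. -/
lemma existsUnique_thetaStar (D : SupportData h H a b L) :
    ∃ θ ∈ Ioc (a - 2 * π) (a - 3 * π / 2), -H (θ + 3 * π / 2) = h θ ∧
      ∀ θ' ∈ Ioc (a - 2 * π) (a - 3 * π / 2), -H (θ' + 3 * π / 2) = h θ' → θ' = θ := by
  have hπ := pi_pos
  have hcont : Continuous fun θ => h θ + H (θ + 3 * π / 2) := by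
    have := D.differentiable.continuous
    have := D.continuous
    fun_prop
  have hmono : StrictMonoOn (fun θ => h θ + H (θ + 3 * π / 2))
      (Icc (a - 2 * π) (a - 3 * π / 2)) := by
    intro x hx y hy hxy
    have h1 := D.monotoneOn_near
      (show x + 2 * π ∈ Icc a (a + π / 2) from ⟨by linarith [hx.1], by linarith [hx.2]⟩)
      (show y + 2 * π ∈ Icc a (a + π / 2) from ⟨by linarith [hy.1], by linarith [hy.2]⟩)
      (by linarith)
    simp only [D.periodic] at h1
    have h2 : H (x + 3 * π / 2) < H (y + 3 * π / 2) :=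
      D.primitive_lt (by linarith) fun z hz =>
        D.pos_left z (by linarith [hz.1, hx.1]) (by linarith [hz.2, hy.2])
    simp only
    linarith
  have hlow : h (a - 2 * π) + H (a - 2 * π + 3 * π / 2) < 0 := by
    rw [D.h_left_sub]
    linarith [D.primitive_neg (show a - 2 * π + 3 * π / 2 < a by linarith)]
  have hhigh : 0 ≤ h (a - 3 * π / 2) + H (a - 3 * π / 2 + 3 * π / 2) := by
    rw [sub_add_cancel, D.H_left]
    linarith [D.nonneg (a - 3 * π / 2)]
  obtain ⟨θ, hθ, h0⟩ := intermediate_value_Ioc (show a - 2 * π ≤ a - 3 * π / 2 by linarith)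
    hcont.continuousOn ⟨hlow, hhigh⟩
  refine ⟨θ, hθ, by linarith, fun θ' hθ' h1 => ?_⟩
  refine hmono.injOn ⟨hθ'.1.le, hθ'.2⟩ ⟨hθ.1.le, hθ.2⟩ ?_
  linarith

/-- At `ϑ*_r` the minimal gap is already less than `-L`, as is seen from the direction opposite to
`n_{ϑ*_r}`. -/
lemma minGap_thetaStar_lt (D : SupportData h H a b L) {θ : ℝ}
    (hθ : θ ∈ Ioc (a - 2 * π) (a - 3 * π / 2)) (he : -H (θ + 3 * π / 2) = h θ) :
    minGap h H θ < -L := by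
  have hπ := pi_pos
  refine (D.minGap_le (φ := θ + π) (by linarith) le_rfl).trans_lt ?_
  rw [gap_add_pi]
  have h1 : H (θ + π) < H (θ + 3 * π / 2) :=
    D.primitive_lt (by linarith) fun z hz =>
      D.pos_left z (by linarith [hz.1, hθ.1]) (by linarith [hz.2, hθ.2])
  have h2 := D.primitive_turn θ
  have h3 := D.periodic θ
  set β := θ + 2 * π with hβ
  have hd : ∀ x, HasDerivAt (fun x => h β * (1 - cos (x - a)) - sin (β - a) * H x)
      (h β * sin (x - a) - sin (β - a) * h x) x := fun x => by
    have h1 : HasDerivAt (fun x => x - a) 1 x := (hasDerivAt_id x).sub_const a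
    refine (((h1.cos.const_sub 1).const_mul (h β)).sub
      ((D.hasDerivAt x).const_mul (sin (β - a)))).congr_deriv ?_
    ring
  have hm : MonotoneOn (fun x => h β * (1 - cos (x - a)) - sin (β - a) * H x) (Icc a β) := by
    refine monotoneOn_of_deriv_nonneg (convex_Icc _ _)
      (fun x _ => (hd x).continuousAt.continuousWithinAt)
      (fun x _ => (hd x).differentiableAt.differentiableWithinAt) fun x hx => ?_
    rw [interior_Icc] at hx
    rw [(hd x).deriv]
    have hsub := D.sublinear hx.1.le hx.2.le (by linarith [hθ.2])
    rw [D.h_left] at hsub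
    linarith
  have hβa : a < β := by linarith [hθ.1]
  have hfin := hm (left_mem_Icc.2 hβa.le) (right_mem_Icc.2 hβa.le) hβa.le
  simp only [sub_self, cos_zero, mul_zero, D.H_left] at hfin
  have s1 : 0 < sin (β - a) := sin_pos_of_pos_of_lt_pi (by linarith) (by linarith [hθ.2])
  have c1 : 0 ≤ cos (β - a) := cos_nonneg_of_mem_Icc ⟨by linarith, by linarith [hθ.2]⟩
  have hle : 1 - cos (β - a) ≤ sin (β - a) := by
    nlinarith [sin_sq_add_cos_sq (β - a), sin_le_one (β - a), cos_le_one (β - a)]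
  have : sin (β - a) * H β ≤ sin (β - a) * h β := by
    nlinarith [mul_le_mul_of_nonneg_left hle (D.nonneg β)]
  have := le_of_mul_le_mul_left this s1
  linarith

/-- The parameter `ψ` at which the right involute meets the left one lies between `ϑ*_r` and
`b - π / 2`. -/
lemma meet_bounds (D : SupportData h H a b L) {φ ψ : ℝ} (hψ : ψ < a)
    (hφ : φ - 2 * π ∈ Ioc ψ (ψ + π)) (h0 : normalGap h H φ ψ = 0) (hg : gap h H φ ψ = 0) :
    ψ < b - π / 2 ∧ ∀ θ ∈ Ioc (a - 2 * π) (a - 3 * π / 2), -H (θ + 3 * π / 2) = h θ → θ < ψ := by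
  have hval : minGap h H ψ = -L := by
    have e : φ = (φ - 2 * π) + ((1 : ℤ) : ℝ) * (2 * π) := by push_cast; ring
    rw [e, D.normalGap_add_int] at h0
    rw [e, D.gap_add_int] at hg
    rw [D.minGap_eq hψ hφ h0]
    push_cast at hg
    linarith
  refine ⟨?_, fun θ hθ he => ?_⟩
  · by_contra hcon
    push Not at hcon
    have h1 := D.strictMonoOn_minGap.monotoneOn (lt_of_le_of_lt hcon hψ) hψ hcon
    linarith [D.neg_length_lt_minGap]
  · by_contra hcon
    push Not at hcon
    have h1 := D.strictMonoOn_minGap.monotoneOn hψ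
      (show θ < a by linarith [hθ.2, pi_pos]) hcon
    linarith [D.minGap_thetaStar_lt hθ he]

/-- Coincidence of the points of parameters `φ` and `ψ` is symmetric, up to a reflection. -/
lemma meet_reflect {φ ψ : ℝ} (h0 : normalGap h H φ ψ = 0) (hg : gap h H φ ψ = 0) :
    normalGap (fun x => h (-x)) (fun x => -H (-x)) (-ψ) (-φ) = 0 ∧
      gap (fun x => h (-x)) (fun x => -H (-x)) (-ψ) (-φ) = 0 := by
  have hcs := sin_sq_add_cos_sq (φ - ψ)
  simp only [normalGap, gap] at h0 hg
  have e : -ψ - -φ = φ - ψ := by ring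
  simp only [normalGap, gap, neg_neg, e]
  constructor
  · linear_combination (-(cos (φ - ψ))) * h0 - sin (φ - ψ) * hg - h ψ * hcs
  · linear_combination cos (φ - ψ) * hg - sin (φ - ψ) * h0 + H ψ * hcs

end SupportData

/-! ### The frame `n_ϑ`, `t_ϑ` -/

lemma inner_nvec (φ : ℝ) (v : Plane) : inner ℝ (nvec φ) v = cos φ * v 0 + sin φ * v 1 := by
  simp [nvec, PiLp.inner_apply, Fin.sum_univ_two]; ring

lemma inner_tvec (φ : ℝ) (v : Plane) : inner ℝ (tvec φ) v = -sin φ * v 0 + cos φ * v 1 := by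
  simp [tvec, PiLp.inner_apply, Fin.sum_univ_two]; ring

lemma inner_nvec_nvec (φ x : ℝ) : inner ℝ (nvec φ) (nvec x) = cos (φ - x) := by
  rw [inner_nvec, cos_sub]; simp [nvec]

lemma inner_nvec_tvec (φ x : ℝ) : inner ℝ (nvec φ) (tvec x) = sin (φ - x) := by
  rw [inner_nvec, sin_sub]; simp [tvec]; ring

lemma inner_tvec_tvec (φ x : ℝ) : inner ℝ (tvec φ) (tvec x) = cos (φ - x) := by
  rw [inner_tvec, cos_sub]; simp [tvec]; ring

lemma inner_tvec_nvec (φ x : ℝ) : inner ℝ (tvec φ) (nvec x) = -sin (φ - x) := by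
  rw [inner_tvec, sin_sub]; simp [nvec]; ring

lemma nvec_add_pi_div_two (φ : ℝ) : nvec (φ + π / 2) = tvec φ := by
  simp [nvec, tvec, cos_add_pi_div_two, sin_add_pi_div_two]

lemma nvec_add_pi (φ : ℝ) : nvec (φ + π) = -nvec φ := by
  ext i; fin_cases i <;> simp [nvec]

lemma nvec_add_two_pi (φ : ℝ) : nvec (φ + 2 * π) = nvec φ := by simp [nvec]

lemma tvec_add_two_pi (φ : ℝ) : tvec (φ + 2 * π) = tvec φ := by simp [tvec]

lemma continuous_nvec : Continuous nvec := by
  unfold nvec; fun_prop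

lemma continuous_tvec : Continuous tvec := by
  unfold tvec; fun_prop

/-- The expansion of a vector in the orthonormal basis `n_φ`, `t_φ`. -/
lemma eq_inner_smul_add (φ : ℝ) (v : Plane) :
    v = inner ℝ (nvec φ) v • nvec φ + inner ℝ (tvec φ) v • tvec φ := by
  have hcs := sin_sq_add_cos_sq φ
  rw [inner_nvec, inner_tvec]
  ext i
  fin_cases i
  · simp [nvec, tvec]; linear_combination (-v 0) * hcs
  · simp [nvec, tvec]; linear_combination (-v 1) * hcs

/-! ### The support function and the involutes in terms of the parametrization -/

/-- The support function of `K` with respect to `x₀ = xl s₀`, as a function of the angle. -/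
noncomputable def supportFun (xl : ℝ → Plane) (ω : ℝ → ℝ) (s₀ ϑ : ℝ) : ℝ :=
  inner ℝ (nvec ϑ) (xl (sLeft ω ϑ) - xl s₀)

/-- The primitive of the support function that vanishes at the normals of `x₀`: the difference
between the arc length from `x₀` to the contact point of angle `ϑ` and the component along `t_ϑ` of
the vector from `x₀` to the contact point. -/
noncomputable def supportPrimitive (xl : ℝ → Plane) (ω : ℝ → ℝ) (s₀ ϑ : ℝ) : ℝ :=
  (sLeft ω ϑ - s₀) - inner ℝ (tvec ϑ) (xl (sLeft ω ϑ) - xl s₀)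

namespace IsCcwArcLengthParam

variable {K : Set Plane} {L : ℝ} {xl : ℝ → Plane} {ω : ℝ → ℝ}

lemma angle_add_int (hx : IsCcwArcLengthParam K L xl ω) (s : ℝ) (n : ℕ) :
    ω (s + n * L) = ω s + n * (2 * π) ∧ ω (s - n * L) = ω s - n * (2 * π) := by
  induction n with
  | zero => simp
  | succ n ih =>
    have h1 := hx.angle_turn (s + n * L)
    have h2 := hx.angle_turn (s - (n + 1) * L)
    rw [show s - (n + 1) * L + L = s - n * L by ring, ih.2] at h2
    rw [ih.1] at h1
    push_cast
    rw [show s + (n + 1) * L = s + n * L + L by ring]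
    constructor <;> linarith

lemma exists_angle_le (hx : IsCcwArcLengthParam K L xl ω) (ϑ : ℝ) : ∃ s, ω s ≤ ϑ := by
  obtain ⟨n, hn⟩ := exists_nat_ge ((ω 0 - ϑ) / (2 * π))
  rw [div_le_iff₀ two_pi_pos] at hn
  exact ⟨0 - n * L, by rw [(hx.angle_add_int 0 n).2]; linarith⟩

lemma exists_lt_angle (hx : IsCcwArcLengthParam K L xl ω) (ϑ : ℝ) : ∃ s, ϑ < ω s := by
  obtain ⟨n, hn⟩ := exists_nat_gt ((ϑ - ω 0) / (2 * π))
  rw [div_lt_iff₀ two_pi_pos] at hn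
  exact ⟨0 + n * L, by rw [(hx.angle_add_int 0 n).1]; linarith⟩

lemma bddAbove_angle_le (hx : IsCcwArcLengthParam K L xl ω) (ϑ : ℝ) :
    BddAbove {s | ω s ≤ ϑ} := by
  obtain ⟨c, hc⟩ := hx.exists_lt_angle ϑ
  exact ⟨c, fun s hs => le_of_lt (hx.angle_mono.reflect_lt (lt_of_le_of_lt hs hc))⟩

lemma le_sLeft (hx : IsCcwArcLengthParam K L xl ω) {s ϑ : ℝ} (h : ω s ≤ ϑ) : s ≤ sLeft ω ϑ :=
  le_csSup (hx.bddAbove_angle_le ϑ) h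

lemma lt_angle (hx : IsCcwArcLengthParam K L xl ω) {s ϑ : ℝ} (h : sLeft ω ϑ < s) : ϑ < ω s := by
  by_contra hcon
  push Not at hcon
  exact absurd (hx.le_sLeft hcon) (not_le.2 h)

lemma angle_le (hx : IsCcwArcLengthParam K L xl ω) {s ϑ : ℝ} (h : s < sLeft ω ϑ) : ω s ≤ ϑ := by
  obtain ⟨u, hu, hsu⟩ := exists_lt_of_lt_csSup (hx.exists_angle_le ϑ) h
  exact (hx.angle_mono hsu.le).trans hu

lemma sLeft_le (hx : IsCcwArcLengthParam K L xl ω) {s ϑ : ℝ} (h : ϑ < ω s) : sLeft ω ϑ ≤ s := by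
  by_contra hcon
  push Not at hcon
  exact absurd (hx.angle_le hcon) (not_le.2 h)

lemma sLeft_mono (hx : IsCcwArcLengthParam K L xl ω) : Monotone (sLeft ω) := by
  intro x y hxy
  by_contra hcon
  push Not at hcon
  obtain ⟨u, hu1, hu2⟩ := exists_between hcon
  linarith [hx.lt_angle hu1, hx.angle_le hu2]

lemma sLeft_turn (hx : IsCcwArcLengthParam K L xl ω) (ϑ : ℝ) :
    sLeft ω (ϑ + 2 * π) = sLeft ω ϑ + L := by
  refine le_antisymm ?_ ?_
  · by_contra hcon
    push Not at hcon
    obtain ⟨u, hu1, hu2⟩ := exists_between hcon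
    have h1 := hx.lt_angle (show sLeft ω ϑ < u - L by linarith)
    have h2 := hx.angle_le hu2
    have h3 := hx.angle_turn (u - L)
    rw [sub_add_cancel] at h3
    linarith
  · by_contra hcon
    push Not at hcon
    obtain ⟨u, hu1, hu2⟩ := exists_between hcon
    have h1 := hx.angle_le (show u - L < sLeft ω ϑ by linarith)
    have h2 := hx.lt_angle hu1
    have h3 := hx.angle_turn (u - L)
    rw [sub_add_cancel] at h3
    linarith

lemma bddAbove_le_angle (hx : IsCcwArcLengthParam K L xl ω) (s₀ ϑ : ℝ) :
    BddAbove {s | ϑ ≤ ω (2 * s₀ - s)} := by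
  obtain ⟨c, hc⟩ := hx.exists_angle_le (ϑ - 1)
  refine ⟨2 * s₀ - c, fun s hs => ?_⟩
  have h1 : c < 2 * s₀ - s :=
    hx.angle_mono.reflect_lt (lt_of_lt_of_le (show ω c < ϑ by linarith) hs)
  linarith

lemma le_sRight (hx : IsCcwArcLengthParam K L xl ω) {s₀ u ϑ : ℝ} (h : ϑ ≤ ω u) :
    2 * s₀ - sRight ω s₀ ϑ ≤ u := by
  have : 2 * s₀ - u ≤ sRight ω s₀ ϑ :=
    le_csSup (hx.bddAbove_le_angle s₀ ϑ) (by simpa using h)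
  linarith

lemma le_angle (hx : IsCcwArcLengthParam K L xl ω) {s₀ u ϑ : ℝ}
    (h : 2 * s₀ - sRight ω s₀ ϑ < u) : ϑ ≤ ω u := by
  have hne : {s | ϑ ≤ ω (2 * s₀ - s)}.Nonempty := by
    obtain ⟨c, hc⟩ := hx.exists_lt_angle ϑ
    exact ⟨2 * s₀ - c, by simpa using hc.le⟩
  obtain ⟨v, hv, huv⟩ := exists_lt_of_lt_csSup hne (show 2 * s₀ - u < sRight ω s₀ ϑ by linarith)
  exact le_trans hv (hx.angle_mono (by linarith))

lemma exists_angle_lt_right (hx : IsCcwArcLengthParam K L xl ω) {s₀ ϑ : ℝ} (h : ω s₀ < ϑ) :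
    ∃ d > s₀, ω d < ϑ := by
  have h1 : ∀ᶠ u in nhdsWithin s₀ (Ioi s₀), ω u < ϑ :=
    ((hx.angle_rightCont s₀).mono Ioi_subset_Ici_self).eventually (gt_mem_nhds h)
  obtain ⟨d, hd1, hd2⟩ := (h1.and self_mem_nhdsWithin).exists
  exact ⟨d, hd2, hd1⟩

/-- The largest angle of a normal at `x₀` is the right limit of the angle there. -/
lemma anglePlus_eq (hx : IsCcwArcLengthParam K L xl ω) (s₀ : ℝ) : anglePlus ω s₀ = ω s₀ := by
  have hmem : ∀ ϑ, ω s₀ < ϑ → s₀ < sLeft ω ϑ := fun ϑ hϑ => by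
    obtain ⟨d, hd, hlt⟩ := hx.exists_angle_lt_right hϑ
    exact lt_of_lt_of_le hd (hx.le_sLeft hlt.le)
  refine csInf_eq_of_forall_ge_of_forall_gt_exists_lt ⟨ω s₀ + 1, hmem _ (by linarith)⟩
    (fun ϑ hϑ => hx.angle_le hϑ) fun w hw => ?_
  obtain ⟨v, hv1, hv2⟩ := exists_between hw
  exact ⟨v, hmem v hv1, hv2⟩

lemma lt_sRight_iff (hx : IsCcwArcLengthParam K L xl ω) {s₀ ϑ : ℝ} :
    s₀ < sRight ω s₀ ϑ ↔ ∃ u < s₀, ϑ ≤ ω u := by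
  constructor
  · intro h
    obtain ⟨u, hu1, hu2⟩ := exists_between (show 2 * s₀ - sRight ω s₀ ϑ < s₀ by linarith)
    exact ⟨u, hu2, hx.le_angle hu1⟩
  · rintro ⟨u, hu, h⟩
    have := hx.le_sRight (s₀ := s₀) h
    linarith

lemma bddAbove_lt_sRight (hx : IsCcwArcLengthParam K L xl ω) (s₀ : ℝ) :
    BddAbove {ϑ | s₀ < sRight ω s₀ ϑ} := by
  refine ⟨ω s₀, fun ϑ hϑ => ?_⟩
  obtain ⟨u, hu, h⟩ := hx.lt_sRight_iff.1 hϑ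
  exact h.trans (hx.angle_mono hu.le)

lemma angle_le_angleMinus (hx : IsCcwArcLengthParam K L xl ω) {s₀ u : ℝ} (hu : u < s₀) :
    ω u ≤ angleMinus ω s₀ :=
  le_csSup (hx.bddAbove_lt_sRight s₀) (hx.lt_sRight_iff.2 ⟨u, hu, le_rfl⟩)

lemma exists_lt_angle_left (hx : IsCcwArcLengthParam K L xl ω) {s₀ ϑ : ℝ}
    (h : ϑ < angleMinus ω s₀) : ∃ u < s₀, ϑ < ω u := by
  have hne : {ϑ | s₀ < sRight ω s₀ ϑ}.Nonempty :=
    ⟨ω (s₀ - 1), hx.lt_sRight_iff.2 ⟨s₀ - 1, by linarith, le_rfl⟩⟩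
  obtain ⟨ϑ', h1, h2⟩ := exists_lt_of_lt_csSup hne h
  obtain ⟨u, hu, h3⟩ := hx.lt_sRight_iff.1 h1
  exact ⟨u, hu, h2.trans_le h3⟩

lemma angleMinus_le_anglePlus (hx : IsCcwArcLengthParam K L xl ω) (s₀ : ℝ) :
    angleMinus ω s₀ ≤ anglePlus ω s₀ := by
  rw [hx.anglePlus_eq]
  by_contra hcon
  push Not at hcon
  obtain ⟨u, hu, h⟩ := hx.exists_lt_angle_left hcon
  linarith [hx.angle_mono hu.le]

lemma intervalIntegrable (hx : IsCcwArcLengthParam K L xl ω) (v : Plane) (c d : ℝ) :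
    IntervalIntegrable (fun u => inner ℝ v (tvec (ω u))) MeasureTheory.volume c d := by
  have hm : Measurable fun u => inner ℝ v (tvec (ω u)) := by
    have hc : Continuous fun x => inner ℝ v (tvec x) := continuous_const.inner continuous_tvec
    exact hc.measurable.comp hx.angle_mono.measurable
  refine (intervalIntegrable_const (c := ‖v‖)).mono_fun' hm.aestronglyMeasurable ?_
  refine Filter.Eventually.of_forall fun u => ?_
  have h1 : ‖tvec (ω u)‖ = 1 := by
    have h2 := real_inner_self_eq_norm_sq (tvec (ω u))
    rw [inner_tvec_tvec, sub_self, cos_zero] at h2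
    nlinarith [norm_nonneg (tvec (ω u))]
  simpa [h1] using norm_inner_le_norm (𝕜 := ℝ) v (tvec (ω u))

/-- The curve is the integral of its right tangent. -/
lemma inner_sub_eq_integral (hx : IsCcwArcLengthParam K L xl ω) (v : Plane) (c d : ℝ) :
    inner ℝ v (xl d - xl c) = ∫ u in c..d, inner ℝ v (tvec (ω u)) := by
  have hcont : Continuous fun u => inner ℝ v (xl u) := continuous_const.inner hx.continuous
  rw [intervalIntegral.integral_eq_sub_of_hasDeriv_right hcont.continuousOn ?_
    (hx.intervalIntegrable v c d), inner_sub_right]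
  intro u _
  have h1 := (hx.unit_speed u).mono Ioi_subset_Ici_self
  have h2 := ((innerSL ℝ v).hasFDerivAt (x := xl u)).comp_hasDerivWithinAt u h1
  exact h2

lemma inner_sub_le (hx : IsCcwArcLengthParam K L xl ω) {v : Plane} {c d M : ℝ} (hcd : c ≤ d)
    (hM : ∀ u ∈ Ioo c d, inner ℝ v (tvec (ω u)) ≤ M) :
    inner ℝ v (xl d - xl c) ≤ (d - c) * M := by
  rw [hx.inner_sub_eq_integral]
  have := intervalIntegral.integral_mono_on_of_le_Ioo hcd (hx.intervalIntegrable v c d)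
    (intervalIntegrable_const (c := M)) hM
  simpa using this

lemma le_inner_sub (hx : IsCcwArcLengthParam K L xl ω) {v : Plane} {c d M : ℝ} (hcd : c ≤ d)
    (hM : ∀ u ∈ Ioo c d, M ≤ inner ℝ v (tvec (ω u))) :
    (d - c) * M ≤ inner ℝ v (xl d - xl c) := by
  rw [hx.inner_sub_eq_integral]
  have := intervalIntegral.integral_mono_on_of_le_Ioo hcd
    (intervalIntegrable_const (c := M)) (hx.intervalIntegrable v c d) hM
  simpa using this

lemma inner_sub_pos (hx : IsCcwArcLengthParam K L xl ω) {v : Plane} {c d : ℝ} (hcd : c < d)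
    (hM : ∀ u ∈ Ioo c d, 0 < inner ℝ v (tvec (ω u))) : 0 < inner ℝ v (xl d - xl c) := by
  rw [hx.inner_sub_eq_integral]
  exact intervalIntegral.intervalIntegral_pos_of_pos_on (hx.intervalIntegrable v c d) hM hcd

lemma sub_eq_smul (hx : IsCcwArcLengthParam K L xl ω) {c d ϑ : ℝ} (hcd : c ≤ d)
    (hω : ∀ u ∈ Ioo c d, ω u = ϑ) : xl d - xl c = (d - c) • tvec ϑ := by
  refine ext_inner_left ℝ fun v => ?_
  rw [inner_smul_right]
  exact le_antisymm (hx.inner_sub_le hcd fun u hu => by rw [hω u hu])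
    (hx.le_inner_sub hcd fun u hu => by rw [hω u hu])

/-- Both involutes are arcs of one curve. -/
lemma rightInvolute_eq (hx : IsCcwArcLengthParam K L xl ω) (s₀ ϑ : ℝ) :
    rightInvolute xl ω s₀ ϑ = leftInvolute xl ω s₀ ϑ := by
  have hle : 2 * s₀ - sRight ω s₀ ϑ ≤ sLeft ω ϑ := by
    by_contra hcon
    push Not at hcon
    obtain ⟨u, hu1, hu2⟩ := exists_between hcon
    exact absurd (hx.le_sRight (hx.lt_angle hu1).le) (not_le.2 hu2)
  have h1 := hx.sub_eq_smul (ϑ := ϑ) hle fun u hu =>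
    le_antisymm (hx.angle_le hu.2) (hx.le_angle hu.1)
  rw [rightInvolute, leftInvolute, rightParam, sub_eq_iff_eq_add.1 h1]
  module

/-- The line with normal `n_ϑ` through `xl (sLeft ω ϑ)` supports the curve. -/
lemma inner_nvec_sub_nonpos (hx : IsCcwArcLengthParam K L xl ω) (ϑ u : ℝ) :
    inner ℝ (nvec ϑ) (xl u - xl (sLeft ω ϑ)) ≤ 0 := by
  have hper : Function.Periodic xl L := hx.periodic
  obtain ⟨y, hy, hyu⟩ := hper.exists_mem_Ico hx.length_pos u (sLeft ω ϑ)
  rw [hyu]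
  rcases le_or_gt (ω y) (ϑ + π) with h1 | h1
  · have := hx.inner_sub_le (v := nvec ϑ) (M := 0) hy.1 fun w hw => by
      rw [inner_nvec_tvec]
      exact sin_nonpos_of_nonpos_of_neg_pi_le (by linarith [hx.lt_angle hw.1])
        (by linarith [hx.angle_mono hw.2.le])
    simpa using this
  · -- past the opposite support line the curve returns towards its starting point
    have := hx.le_inner_sub (v := nvec ϑ) (M := 0) hy.2.le fun w hw => by
      rw [inner_nvec_tvec]
      have h2 := hx.angle_le (show w - L < sLeft ω ϑ by linarith [hw.2])
      have h3 := hx.angle_turn (w - L)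
      rw [sub_add_cancel] at h3
      rw [← sin_add_two_pi]
      exact sin_nonneg_of_nonneg_of_le_pi (by linarith) (by linarith [hx.angle_mono hw.1.le])
    rw [hx.periodic, ← neg_sub (xl y), inner_neg_right] at this
    linarith

lemma mem_frontier (hx : IsCcwArcLengthParam K L xl ω) (u : ℝ) : xl u ∈ frontier K := by
  rw [← hx.range_eq]; exact mem_range_self u

lemma mem (hx : IsCcwArcLengthParam K L xl ω) (hK : IsCompact K) (u : ℝ) : xl u ∈ K :=
  hK.isClosed.frontier_subset (hx.mem_frontier u)

lemma inner_nvec_sub_nonpos_of_mem (hx : IsCcwArcLengthParam K L xl ω) (hK : IsCompact K)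
    (ϑ : ℝ) {y : Plane} (hy : y ∈ K) : inner ℝ (nvec ϑ) (y - xl (sLeft ω ϑ)) ≤ 0 := by
  have hcont : Continuous fun z : Plane => inner ℝ (nvec ϑ) z :=
    continuous_const.inner continuous_id
  obtain ⟨z, hz, hmax⟩ := hK.exists_isMaxOn ⟨y, hy⟩ hcont.continuousOn
  have hzf : z ∈ frontier K := by
    refine ⟨subset_closure hz, fun hint => ?_⟩
    have h1 : Filter.Tendsto (fun c : ℝ => z + c • nvec ϑ) (nhdsWithin 0 (Ioi 0)) (nhds z) := by
      have h2 : Continuous fun c : ℝ => z + c • nvec ϑ := by fun_prop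
      have := h2.tendsto 0
      rw [zero_smul, add_zero] at this
      exact this.mono_left nhdsWithin_le_nhds
    obtain ⟨c, hc1, hc2⟩ :=
      ((h1.eventually (mem_interior_iff_mem_nhds.1 hint)).and self_mem_nhdsWithin).exists
    have h3 : inner ℝ (nvec ϑ) (z + c • nvec ϑ) ≤ inner ℝ (nvec ϑ) z := hmax hc1
    rw [inner_add_right, inner_smul_right, inner_nvec_nvec, sub_self, cos_zero] at h3
    have : (0 : ℝ) < c := hc2
    linarith
  rw [← hx.range_eq] at hzf
  obtain ⟨u, rfl⟩ := hzf
  have h1 := hx.inner_nvec_sub_nonpos ϑ u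
  have h2 : inner ℝ (nvec ϑ) y ≤ inner ℝ (nvec ϑ) (xl u) := hmax hy
  rw [inner_sub_right] at h1 ⊢
  linarith

lemma sLeft_mem_gaussFace (hx : IsCcwArcLengthParam K L xl ω) (hK : IsCompact K) (ϑ : ℝ) :
    xl (sLeft ω ϑ) ∈ gaussFace K ϑ :=
  ⟨hx.mem_frontier _, fun _ hy => hx.inner_nvec_sub_nonpos_of_mem hK ϑ hy⟩

lemma le_supportFun (hx : IsCcwArcLengthParam K L xl ω) (hK : IsCompact K) (s₀ ϑ : ℝ) {y : Plane}
    (hy : y ∈ K) : inner ℝ (nvec ϑ) (y - xl s₀) ≤ supportFun xl ω s₀ ϑ := by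
  have := hx.inner_nvec_sub_nonpos_of_mem hK ϑ hy
  rw [supportFun]
  rw [inner_sub_right] at this ⊢
  rw [inner_sub_right]
  linarith

/-- The line with normal `n_ϑ` through a point `A` supports `K` exactly if the signed distance of
`A` from `x₀` in the direction `n_ϑ` is the value of the support function. -/
lemma exists_gaussFace_iff (hx : IsCcwArcLengthParam K L xl ω) (hK : IsCompact K) (s₀ ϑ : ℝ)
    (A : Plane) : (∃ B ∈ gaussFace K ϑ, inner ℝ (nvec ϑ) (A - B) = 0) ↔
      inner ℝ (nvec ϑ) (A - xl s₀) = supportFun xl ω s₀ ϑ := by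
  have hface := hx.sLeft_mem_gaussFace hK ϑ
  constructor
  · rintro ⟨B, hB, h0⟩
    have h1 := hB.2 _ (hx.mem hK (sLeft ω ϑ))
    have h2 := hface.2 _ (hK.isClosed.frontier_subset hB.1)
    simp only [supportFun, inner_sub_right] at *
    linarith
  · intro h
    refine ⟨_, hface, ?_⟩
    simp only [supportFun, inner_sub_right] at *
    linarith

/-- The involute in the moving frame `n_ϑ`, `t_ϑ`. -/
lemma leftInvolute_sub (xl : ℝ → Plane) (ω : ℝ → ℝ) (s₀ ϑ : ℝ) :
    leftInvolute xl ω s₀ ϑ - xl s₀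
      = supportFun xl ω s₀ ϑ • nvec ϑ - supportPrimitive xl ω s₀ ϑ • tvec ϑ := by
  have h1 := eq_inner_smul_add ϑ (xl (sLeft ω ϑ) - xl s₀)
  rw [leftInvolute, supportFun, supportPrimitive, sub_right_comm]
  conv_lhs => rw [h1]
  module

lemma gap_eq_inner (xl : ℝ → Plane) (ω : ℝ → ℝ) (s₀ φ ψ : ℝ) :
    gap (supportFun xl ω s₀) (supportPrimitive xl ω s₀) φ ψ
      = supportPrimitive xl ω s₀ φ + inner ℝ (tvec φ) (leftInvolute xl ω s₀ ψ - xl s₀) := by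
  rw [leftInvolute_sub, inner_sub_right, inner_smul_right, inner_smul_right, inner_tvec_tvec,
    inner_tvec_nvec, gap]
  ring

lemma normalGap_eq_inner (xl : ℝ → Plane) (ω : ℝ → ℝ) (s₀ φ ψ : ℝ) :
    normalGap (supportFun xl ω s₀) (supportPrimitive xl ω s₀) φ ψ
      = supportFun xl ω s₀ φ - inner ℝ (nvec φ) (leftInvolute xl ω s₀ ψ - xl s₀) := by
  rw [leftInvolute_sub, inner_sub_right, inner_smul_right, inner_smul_right, inner_nvec_tvec,
    inner_nvec_nvec, normalGap]
  ring

lemma leftInvolute_eq_iff (xl : ℝ → Plane) (ω : ℝ → ℝ) (s₀ φ ψ : ℝ) :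
    leftInvolute xl ω s₀ φ = leftInvolute xl ω s₀ ψ ↔
      normalGap (supportFun xl ω s₀) (supportPrimitive xl ω s₀) φ ψ = 0 ∧
        gap (supportFun xl ω s₀) (supportPrimitive xl ω s₀) φ ψ = 0 := by
  have h1 := normalGap_eq_inner xl ω s₀ φ φ
  have h2 := gap_eq_inner xl ω s₀ φ φ
  rw [normalGap_self] at h1
  rw [gap_self] at h2
  rw [normalGap_eq_inner, gap_eq_inner]
  constructor
  · intro h
    rw [← h]
    exact ⟨h1.symm, h2.symm⟩
  · rintro ⟨h3, h4⟩
    have e1 := eq_inner_smul_add φ (leftInvolute xl ω s₀ φ - xl s₀)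
    have e2 := eq_inner_smul_add φ (leftInvolute xl ω s₀ ψ - xl s₀)
    rw [show inner ℝ (nvec φ) (leftInvolute xl ω s₀ ψ - xl s₀)
        = inner ℝ (nvec φ) (leftInvolute xl ω s₀ φ - xl s₀) by linarith,
      show inner ℝ (tvec φ) (leftInvolute xl ω s₀ ψ - xl s₀)
        = inner ℝ (tvec φ) (leftInvolute xl ω s₀ φ - xl s₀) by linarith, ← e1] at e2
    exact (sub_left_injective e2).symm

lemma continuous_supportFun (hx : IsCcwArcLengthParam K L xl ω) (hK : IsCompact K) (s₀ : ℝ) :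
    Continuous (supportFun xl ω s₀) := by
  have heq : supportFun xl ω s₀
      = fun ϑ => sSup ((fun y => inner ℝ (nvec ϑ) (y - xl s₀)) '' K) := by
    funext ϑ
    symm
    refine IsGreatest.csSup_eq ⟨⟨_, hx.mem hK (sLeft ω ϑ), rfl⟩, ?_⟩
    rintro _ ⟨y, hy, rfl⟩
    exact hx.le_supportFun hK s₀ ϑ hy
  rw [heq]
  refine hK.continuous_sSup ?_
  have := continuous_nvec
  change Continuous fun p : ℝ × Plane => inner ℝ (nvec p.1) (p.2 - xl s₀)
  fun_prop

lemma hasDerivAt_inner_tvec (v : Plane) (x : ℝ) :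
    HasDerivAt (fun y => inner ℝ (tvec y) v) (-inner ℝ (nvec x) v) x := by
  simp only [inner_tvec, inner_nvec]
  refine (((hasDerivAt_sin x).neg.mul_const (v 0)).add
    ((hasDerivAt_cos x).mul_const (v 1))).congr_deriv ?_
  ring

/-- Keeping the contact point fixed when the angle varies changes `supportPrimitive` only
to second order. -/
lemma hasDerivAt_supportPrimitive (hx : IsCcwArcLengthParam K L xl ω) (s₀ x : ℝ) :
    HasDerivAt (supportPrimitive xl ω s₀) (supportFun xl ω s₀ x) x := by
  set s := sLeft ω x with hs
  set E : ℝ → ℝ := fun y => (sLeft ω y - s) - inner ℝ (tvec y) (xl (sLeft ω y) - xl s) with hE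
  have hbound : ∀ y, |y - x| ≤ 1 → ‖E y‖ ≤ (sLeft ω (x + 1) - sLeft ω (x - 1)) * ‖y - x‖ ^ 2 := by
    intro y hy
    rw [abs_le] at hy
    have hup := hx.sLeft_mono (show y ≤ x + 1 by linarith)
    have hlo := hx.sLeft_mono (show x - 1 ≤ y by linarith)
    have hup' := hx.sLeft_mono (show x ≤ x + 1 by linarith)
    have hlo' := hx.sLeft_mono (show x - 1 ≤ x by linarith)
    have hcos : ∀ u, |y - ω u| ≤ |y - x| → 1 - (y - x) ^ 2 ≤ inner ℝ (tvec y) (tvec (ω u)) := by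
      intro u hu
      rw [inner_tvec_tvec]
      have h1 := one_sub_sq_div_two_le_cos (x := y - ω u)
      have h2 := sq_le_sq.2 hu
      nlinarith [sq_nonneg (y - ω u)]
    have hcos1 : ∀ u, inner ℝ (tvec y) (tvec (ω u)) ≤ 1 := fun u => by
      rw [inner_tvec_tvec]; exact cos_le_one _
    rw [norm_eq_abs, norm_eq_abs, sq_abs]
    have hsq := sq_nonneg (y - x)
    rcases le_total x y with hxy | hxy
    · have h0 : s ≤ sLeft ω y := hx.sLeft_mono hxy
      have h1 := hx.le_inner_sub h0 fun u hu => hcos u (by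
        have a1 := hx.lt_angle hu.1
        have a2 := hx.angle_le hu.2
        rw [abs_of_nonneg (by linarith), abs_of_nonneg (by linarith)]; linarith)
      have h2 := hx.inner_sub_le h0 fun u _ => hcos1 u
      rw [abs_le]
      constructor
      · simp only [hE]
        have := mul_nonneg (show 0 ≤ sLeft ω (x + 1) - sLeft ω (x - 1) by linarith) hsq
        linarith
      · simp only [hE]
        have := mul_le_mul_of_nonneg_right
          (show sLeft ω y - s ≤ sLeft ω (x + 1) - sLeft ω (x - 1) by linarith) hsq
        linarith
    · have h0 : sLeft ω y ≤ s := hx.sLeft_mono hxy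
      have h1 := hx.le_inner_sub h0 fun u hu => hcos u (by
        have a1 := hx.lt_angle hu.1
        have a2 := hx.angle_le hu.2
        rw [abs_of_nonpos (by linarith), abs_of_nonpos (by linarith)]; linarith)
      have h2 := hx.inner_sub_le h0 fun u _ => hcos1 u
      rw [← neg_sub (xl (sLeft ω y)), inner_neg_right] at h1 h2
      rw [abs_le]
      constructor
      · simp only [hE]
        have := mul_le_mul_of_nonneg_right
          (show s - sLeft ω y ≤ sLeft ω (x + 1) - sLeft ω (x - 1) by linarith) hsq
        linarith
      · simp only [hE]
        have := mul_nonneg (show 0 ≤ sLeft ω (x + 1) - sLeft ω (x - 1) by linarith) hsq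
        linarith
  have hEd : HasDerivAt E 0 x := by
    rw [hasDerivAt_iff_isLittleO]
    have hE0 : E x = 0 := by simp [hE, hs]
    simp only [hE0, sub_zero, smul_zero]
    refine Asymptotics.IsBigO.trans_isLittleO ?_
      (Asymptotics.isLittleO_pow_sub_sub x (show 1 < 2 by norm_num))
    refine Asymptotics.IsBigO.of_bound (sLeft ω (x + 1) - sLeft ω (x - 1)) ?_
    filter_upwards [Metric.closedBall_mem_nhds x one_pos] with y hy
    have := hbound y (by simpa [Real.dist_eq] using hy)
    simpa using this
  have hF := ((hasDerivAt_inner_tvec (xl s - xl s₀) x).const_sub (s - s₀)).add hEd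
  refine (hF.congr_deriv ?_).congr_of_eventuallyEq (Filter.Eventually.of_forall fun y => ?_)
  · simp [supportFun, hs]
  · simp only [supportPrimitive, hE, Pi.add_apply, inner_sub_right]
    ring

lemma supportFun_eq_zero_and_supportPrimitive_eq_zero (hx : IsCcwArcLengthParam K L xl ω) {s₀ x : ℝ}
    (h : x ∈ Icc (angleMinus ω s₀) (anglePlus ω s₀)) :
    supportFun xl ω s₀ x = 0 ∧ supportPrimitive xl ω s₀ x = 0 := by
  rw [hx.anglePlus_eq] at h
  have hle : s₀ ≤ sLeft ω x := by
    by_contra hcon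
    push Not at hcon
    obtain ⟨u, hu1, hu2⟩ := exists_between hcon
    linarith [hx.lt_angle hu1, hx.angle_le_angleMinus hu2, h.1]
  have h1 := hx.sub_eq_smul (ϑ := x) hle fun u hu =>
    le_antisymm (hx.angle_le hu.2) (h.2.trans (hx.angle_mono hu.1.le))
  rw [supportFun, supportPrimitive, h1, inner_smul_right, inner_smul_right, inner_nvec_tvec,
    inner_tvec_tvec]
  simp

/-- If the normals at `x₀` filled a half turn, `K` would be a segment with endpoint `x₀`. -/
lemma anglePlus_lt (hx : IsCcwArcLengthParam K L xl ω) (hK : IsCompact K) (hconv : Convex ℝ K)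
    {s₀ : ℝ} (hend : ∀ y : Plane, K ≠ segment ℝ (xl s₀) y) :
    anglePlus ω s₀ < angleMinus ω s₀ + π := by
  by_contra hcon
  push Not at hcon
  have hπ := pi_pos
  set a := angleMinus ω s₀ with ha
  have hnormal : ∀ x ∈ Icc a (a + π), ∀ y ∈ K, inner ℝ (nvec x) (y - xl s₀) ≤ 0 := by
    intro x hx1 y hy
    have := hx.le_supportFun hK s₀ x hy
    rwa [(hx.supportFun_eq_zero_and_supportPrimitive_eq_zero ⟨hx1.1, hx1.2.trans hcon⟩).1] at this
  have hzero : ∀ y ∈ K, inner ℝ (nvec a) (y - xl s₀) = 0 := by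
    intro y hy
    have h1 := hnormal a ⟨le_rfl, by linarith⟩ y hy
    have h2 := hnormal (a + π) ⟨by linarith, le_rfl⟩ y hy
    rw [nvec_add_pi, inner_neg_left] at h2
    linarith
  have hneg : ∀ y ∈ K, inner ℝ (tvec a) (y - xl s₀) ≤ 0 := by
    intro y hy
    have h1 := hnormal (a + π / 2) ⟨by linarith, by linarith⟩ y hy
    rwa [nvec_add_pi_div_two] at h1
  have hrep : ∀ y ∈ K, y = xl s₀ + inner ℝ (tvec a) (y - xl s₀) • tvec a := by
    intro y hy
    have h1 := eq_inner_smul_add a (y - xl s₀)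
    rw [hzero y hy, zero_smul, zero_add] at h1
    rw [← h1]; abel
  have hcont : Continuous fun y : Plane => inner ℝ (tvec a) (y - xl s₀) := by fun_prop
  obtain ⟨z, hz, hmin⟩ := hK.exists_isMinOn ⟨_, hx.mem hK s₀⟩ hcont.continuousOn
  refine hend z (Subset.antisymm (fun y hy => ?_)
    (hconv.segment_subset (hx.mem hK s₀) hz))
  have hzy : inner ℝ (tvec a) (z - xl s₀) ≤ inner ℝ (tvec a) (y - xl s₀) := hmin hy
  have hy0 := hneg y hy
  rw [segment_eq_image']
  rcases hy0.lt_or_eq with h1 | h1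
  · refine ⟨inner ℝ (tvec a) (y - xl s₀) / inner ℝ (tvec a) (z - xl s₀),
      ⟨div_nonneg_of_nonpos hy0 (by linarith), ?_⟩, ?_⟩
    · rw [div_le_one_of_neg (by linarith)]; exact hzy
    · have h2 : (inner ℝ (tvec a) (y - xl s₀) / inner ℝ (tvec a) (z - xl s₀)) • (z - xl s₀)
          = inner ℝ (tvec a) (y - xl s₀) • tvec a := by
        have h3 : z - xl s₀ = inner ℝ (tvec a) (z - xl s₀) • tvec a :=
          sub_eq_iff_eq_add'.2 (hrep z hz)
        conv_lhs => rw [h3, inner_smul_right, inner_tvec_tvec, sub_self, cos_zero, mul_one]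
        rw [smul_smul, div_mul_cancel₀ _ (by linarith)]
      simp only
      rw [h2, ← hrep y hy]
  · refine ⟨0, by simp, ?_⟩
    have := hrep y hy
    rw [h1, zero_smul, add_zero] at this
    simp [← this]

/-- The support function of `K` with respect to `x₀` has the properties on which the intersection
argument is based. -/
theorem supportData (hx : IsCcwArcLengthParam K L xl ω) (hK : IsCompact K) (hconv : Convex ℝ K)
    {s₀ : ℝ} (hend : ∀ y : Plane, K ≠ segment ℝ (xl s₀) y) :
    SupportData (supportFun xl ω s₀) (supportPrimitive xl ω s₀) (angleMinus ω s₀)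
      (anglePlus ω s₀) L where
  length_pos := hx.length_pos
  hasDerivAt := hx.hasDerivAt_supportPrimitive s₀
  continuous := hx.continuous_supportFun hK s₀
  periodic x := by
    rw [supportFun, supportFun, hx.sLeft_turn, hx.periodic, nvec_add_two_pi]
  primitive_turn x := by
    rw [supportPrimitive, supportPrimitive, hx.sLeft_turn, hx.periodic, tvec_add_two_pi]
    ring
  nonneg x := by
    have := hx.le_supportFun hK s₀ x (hx.mem hK s₀)
    simpa using this
  sublinear α θ β h1 h2 h3 := by
    have hα := hx.le_supportFun hK s₀ α (hx.mem hK (sLeft ω θ))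
    have hβ := hx.le_supportFun hK s₀ β (hx.mem hK (sLeft ω θ))
    have s1 : 0 ≤ sin (β - θ) := sin_nonneg_of_nonneg_of_le_pi (by linarith) (by linarith)
    have s2 : 0 ≤ sin (θ - α) := sin_nonneg_of_nonneg_of_le_pi (by linarith) (by linarith)
    refine le_trans (le_of_eq ?_)
      (add_le_add (mul_le_mul_of_nonneg_right hα s1) (mul_le_mul_of_nonneg_right hβ s2))
    rw [supportFun]
    simp only [inner_nvec, sin_sub]
    ring
  le := hx.angleMinus_le_anglePlus s₀
  lt_add_pi := hx.anglePlus_lt hK hconv hend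
  eq_zero x h := (hx.supportFun_eq_zero_and_supportPrimitive_eq_zero h).1
  primitive_eq_zero x h := (hx.supportFun_eq_zero_and_supportPrimitive_eq_zero h).2
  pos_right x h1 h2 := by
    rw [hx.anglePlus_eq] at h1 h2
    obtain ⟨d, hd, hlt⟩ := hx.exists_angle_lt_right h1
    have p1 := hx.inner_sub_pos (v := nvec x) hd fun u hu => by
      rw [inner_nvec_tvec]
      exact sin_pos_of_pos_of_lt_pi (by linarith [hx.angle_mono hu.2.le])
        (by linarith [hx.angle_mono hu.1.le])
    have p2 := hx.le_inner_sub (v := nvec x) (M := 0) (hx.le_sLeft hlt.le) fun u hu => by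
      rw [inner_nvec_tvec]
      exact sin_nonneg_of_nonneg_of_le_pi (by linarith [hx.angle_le hu.2])
        (by linarith [hx.angle_mono (hd.le.trans hu.1.le)])
    rw [supportFun]
    simp only [inner_sub_right] at *
    linarith
  pos_left x h1 h2 := by
    obtain ⟨c, hc, hlt⟩ := hx.exists_lt_angle_left h2
    have p1 := hx.inner_sub_pos (v := -nvec x) ((hx.sLeft_le hlt).trans_lt hc) fun u hu => by
      rw [inner_neg_left, inner_nvec_tvec, ← sin_neg]
      exact sin_pos_of_pos_of_lt_pi (by linarith [hx.lt_angle hu.1])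
        (by linarith [hx.angle_le_angleMinus hu.2])
    rw [supportFun]
    simp only [inner_sub_right, inner_neg_left] at *
    linarith
  mono_left φ ψ₁ ψ₂ h1 h2 h3 h4 := by
    obtain ⟨c, hc, hlt⟩ := hx.exists_lt_angle_left h2
    have hs2 : sLeft ω ψ₂ < s₀ := (hx.sLeft_le hlt).trans_lt hc
    have e1 := gap_eq_inner xl ω s₀ φ ψ₁
    have e2 := gap_eq_inner xl ω s₀ φ ψ₂
    rw [gap] at e1 e2
    rw [e1, e2]
    have hb := hx.le_inner_sub (v := tvec φ) (M := cos (φ - ψ₁)) (hx.sLeft_mono h1.le)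
      fun u hu => by
        rw [inner_tvec_tvec]
        exact cos_le_cos_of_nonneg_of_le_pi (by linarith [hx.angle_le hu.2]) (by linarith)
          (by linarith [hx.lt_angle hu.1])
    have hcos : cos (φ - ψ₁) < cos (φ - ψ₂) :=
      cos_lt_cos_of_nonneg_of_le_pi (by linarith) (by linarith) (by linarith)
    have := mul_pos (sub_pos.2 hs2) (sub_pos.2 hcos)
    simp only [leftInvolute, inner_sub_right, inner_smul_right, inner_tvec_tvec] at *
    linarith
  mono_right ψ φ₁ φ₂ h1 h2 h3 h4 := by
    rw [hx.anglePlus_eq] at h2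
    obtain ⟨d, hd, hlt⟩ := hx.exists_angle_lt_right h2
    have hs1 : s₀ < sLeft ω φ₁ := lt_of_lt_of_le hd (hx.le_sLeft hlt.le)
    have e1 := gap_eq_inner xl ω s₀ ψ φ₁
    have e2 := gap_eq_inner xl ω s₀ ψ φ₂
    rw [gap] at e1 e2
    rw [e1, e2]
    have hb := hx.le_inner_sub (v := tvec ψ) (M := cos (ψ - φ₂)) (hx.sLeft_mono h1.le)
      fun u hu => by
        rw [inner_tvec_tvec, ← cos_neg, ← cos_neg (ψ - ω u)]
        exact cos_le_cos_of_nonneg_of_le_pi (by linarith [hx.lt_angle hu.1]) (by linarith)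
          (by linarith [hx.angle_le hu.2])
    have hcos : cos (ψ - φ₂) < cos (ψ - φ₁) := by
      rw [← cos_neg, ← cos_neg (ψ - φ₁)]
      exact cos_lt_cos_of_nonneg_of_le_pi (by linarith) (by linarith) (by linarith)
    have := mul_pos (sub_pos.2 hs1) (sub_pos.2 hcos)
    simp only [leftInvolute, inner_sub_right, inner_smul_right, inner_tvec_tvec] at *
    linarith

lemma inner_sub_nonneg_of_opening {q u v : Plane} (hop : OpeningLeRight K q) (hu : u ∈ K)
    (hv : v ∈ K) : 0 ≤ inner ℝ (u - q) (v - q) := by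
  have hmem : ∀ y ∈ K, y - q ∈ tangentSector K q := fun y hy =>
    subset_closure (mem_biUnion hy ⟨1, zero_le_one, (one_smul _ _).symm⟩)
  have h1 := hop _ (hmem u hu) _ (hmem v hv)
  have h2 := InnerProductGeometry.angle_nonneg (u - q) (v - q)
  rw [← InnerProductGeometry.cos_angle_mul_norm_mul_norm]
  have : 0 ≤ cos (InnerProductGeometry.angle (u - q) (v - q)) :=
    cos_nonneg_of_mem_Icc ⟨by linarith [pi_pos], h1⟩
  positivity

/-- `t_{ϑ₀⁺}` is the direction in which the curve leaves `x₀`, so it makes an angle of at most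
`π / 2` with every vector of a tangent cone of opening at most `π / 2`. -/
lemma inner_tvec_anglePlus_nonneg (hx : IsCcwArcLengthParam K L xl ω) (hK : IsCompact K) {s₀ : ℝ}
    (hop : OpeningLeRight K (xl s₀)) {y : Plane} (hy : y ∈ K) :
    0 ≤ inner ℝ (tvec (anglePlus ω s₀)) (y - xl s₀) := by
  rw [hx.anglePlus_eq]
  by_contra hcon
  push Not at hcon
  have hc : Continuous fun x => inner ℝ (tvec x) (y - xl s₀) :=
    continuous_tvec.inner continuous_const
  have hev : ∀ᶠ u in nhdsWithin s₀ (Ici s₀), inner ℝ (tvec (ω u)) (y - xl s₀) < 0 :=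
    (hc.continuousAt.comp_continuousWithinAt (hx.angle_rightCont s₀)).eventually
      (gt_mem_nhds hcon)
  obtain ⟨d, hd, hsub⟩ := mem_nhdsGE_iff_exists_Ico_subset.1 hev
  have h1 := hx.inner_sub_pos (v := -(y - xl s₀)) hd fun u hu => by
    rw [inner_neg_left, real_inner_comm]
    exact neg_pos.2 (hsub ⟨hu.1.le, hu.2⟩)
  have h2 := inner_sub_nonneg_of_opening hop hy (hx.mem hK d)
  rw [inner_neg_left] at h1
  linarith

/-- `-t_{ϑ₀⁻}` is the direction from `x₀` back along the curve. -/
lemma inner_tvec_angleMinus_nonpos (hx : IsCcwArcLengthParam K L xl ω) (hK : IsCompact K) {s₀ : ℝ}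
    (hop : OpeningLeRight K (xl s₀)) {y : Plane} (hy : y ∈ K) :
    inner ℝ (tvec (angleMinus ω s₀)) (y - xl s₀) ≤ 0 := by
  by_contra hcon
  push Not at hcon
  have hc : Continuous fun x => inner ℝ (tvec x) (y - xl s₀) :=
    continuous_tvec.inner continuous_const
  have hev : ∀ᶠ x in nhdsWithin (angleMinus ω s₀) (Iic (angleMinus ω s₀)),
      0 < inner ℝ (tvec x) (y - xl s₀) :=
    hc.continuousWithinAt.eventually (lt_mem_nhds hcon)
  obtain ⟨x, hxa, hsub⟩ := mem_nhdsLE_iff_exists_Ioc_subset.1 hev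
  obtain ⟨c, hcs, hlt⟩ := hx.exists_lt_angle_left hxa
  have h1 := hx.inner_sub_pos (v := y - xl s₀) hcs fun u hu => by
    rw [real_inner_comm]
    exact hsub ⟨hlt.trans_le (hx.angle_mono hu.1.le), hx.angle_le_angleMinus hu.2⟩
  have h2 := inner_sub_nonneg_of_opening hop hy (hx.mem hK c)
  rw [← neg_sub (xl c), inner_neg_right] at h1
  linarith

end IsCcwArcLengthParam

/-! ### The angles of tangency and the intersection of the involutes -/

namespace IsCcwArcLengthParam

variable {K : Set Plane} {L : ℝ} {xl : ℝ → Plane} {ω : ℝ → ℝ}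

/-- The tangency condition for `ϑ*_l`, in terms of the support function. -/
lemma tangent_left_iff (hx : IsCcwArcLengthParam K L xl ω) (hK : IsCompact K) (s₀ ϑ : ℝ) :
    (∃ B ∈ gaussFace K ϑ, inner ℝ (nvec ϑ) (leftInvolute xl ω s₀ (ϑ - 3 * π / 2) - B) = 0) ↔
      supportPrimitive xl ω s₀ (ϑ - 3 * π / 2) = supportFun xl ω s₀ ϑ := by
  have e : nvec ϑ = -tvec (ϑ - 3 * π / 2) := by
    conv_lhs => rw [show ϑ = ϑ - 3 * π / 2 + π / 2 + π by ring]
    rw [nvec_add_pi, nvec_add_pi_div_two]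
  rw [hx.exists_gaussFace_iff hK s₀, e, inner_neg_left]
  have h2 := gap_eq_inner xl ω s₀ (ϑ - 3 * π / 2) (ϑ - 3 * π / 2)
  rw [gap_self] at h2
  constructor <;> intro h <;> linarith

/-- The tangency condition for `ϑ*_r`, in terms of the support function. -/
lemma tangent_right_iff (hx : IsCcwArcLengthParam K L xl ω) (hK : IsCompact K) (s₀ ϑ : ℝ) :
    (∃ B ∈ gaussFace K ϑ, inner ℝ (nvec ϑ) (rightInvolute xl ω s₀ (ϑ + 3 * π / 2) - B) = 0) ↔
      -supportPrimitive xl ω s₀ (ϑ + 3 * π / 2) = supportFun xl ω s₀ ϑ := by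
  have e : nvec ϑ = tvec (ϑ + 3 * π / 2) := by
    rw [← nvec_add_pi_div_two, ← nvec_add_two_pi]
    congr 1; ring
  rw [hx.exists_gaussFace_iff hK s₀, hx.rightInvolute_eq, e]
  have h2 := gap_eq_inner xl ω s₀ (ϑ + 3 * π / 2) (ϑ + 3 * π / 2)
  rw [gap_self] at h2
  constructor <;> intro h <;> linarith

/-- The case distinction in the definition of `ϑ*_l` is superfluous: if the tangent cone has opening
at most `π / 2`, then `ϑ₀⁺ + 3π/2` satisfies the tangency condition. -/
lemma isThetaStarLeft_iff (hx : IsCcwArcLengthParam K L xl ω) (hK : IsCompact K) {s₀ θ : ℝ}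
    (D : SupportData (supportFun xl ω s₀) (supportPrimitive xl ω s₀) (angleMinus ω s₀)
      (anglePlus ω s₀) L)
    (hθ : θ ∈ Ico (anglePlus ω s₀ + 3 * π / 2) (anglePlus ω s₀ + 2 * π))
    (heq : supportPrimitive xl ω s₀ (θ - 3 * π / 2) = supportFun xl ω s₀ θ)
    (huniq : ∀ ϑ ∈ Ico (anglePlus ω s₀ + 3 * π / 2) (anglePlus ω s₀ + 2 * π),
      supportPrimitive xl ω s₀ (ϑ - 3 * π / 2) = supportFun xl ω s₀ ϑ → ϑ = θ) (ϑ : ℝ) :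
    IsThetaStarLeft K xl ω s₀ ϑ ↔ ϑ = θ := by
  rw [IsThetaStarLeft, hx.tangent_left_iff hK]
  by_cases hop : OpeningLeRight K (xl s₀)
  · simp only [hop, true_and, not_true_eq_false, false_and, or_false]
    have hθe : anglePlus ω s₀ + 3 * π / 2 = θ := by
      refine huniq _ ⟨le_rfl, by linarith [pi_pos]⟩ ?_
      rw [add_sub_cancel_right, D.H_right]
      refine le_antisymm (D.nonneg _) ?_
      have h1 := hx.inner_tvec_anglePlus_nonneg hK hop
        (hx.mem hK (sLeft ω (anglePlus ω s₀ + 3 * π / 2)))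
      have e : nvec (anglePlus ω s₀ + 3 * π / 2) = -tvec (anglePlus ω s₀) := by
        rw [show anglePlus ω s₀ + 3 * π / 2 = anglePlus ω s₀ + π / 2 + π by ring, nvec_add_pi,
          nvec_add_pi_div_two]
      rw [supportFun, e, inner_neg_left]
      linarith
    rw [hθe]
  · simp only [hop, false_and, not_false_eq_true, true_and, false_or]
    constructor
    · rintro ⟨h1, h2, h3⟩
      exact huniq ϑ ⟨h1, h2⟩ h3
    · rintro rfl
      exact ⟨hθ.1, hθ.2, heq⟩

lemma isThetaStarRight_iff (hx : IsCcwArcLengthParam K L xl ω) (hK : IsCompact K) {s₀ θ : ℝ}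
    (D : SupportData (supportFun xl ω s₀) (supportPrimitive xl ω s₀) (angleMinus ω s₀)
      (anglePlus ω s₀) L)
    (hθ : θ ∈ Ioc (angleMinus ω s₀ - 2 * π) (angleMinus ω s₀ - 3 * π / 2))
    (heq : -supportPrimitive xl ω s₀ (θ + 3 * π / 2) = supportFun xl ω s₀ θ)
    (huniq : ∀ ϑ ∈ Ioc (angleMinus ω s₀ - 2 * π) (angleMinus ω s₀ - 3 * π / 2),
      -supportPrimitive xl ω s₀ (ϑ + 3 * π / 2) = supportFun xl ω s₀ ϑ → ϑ = θ) (ϑ : ℝ) :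
    IsThetaStarRight K xl ω s₀ ϑ ↔ ϑ = θ := by
  rw [IsThetaStarRight, hx.tangent_right_iff hK]
  by_cases hop : OpeningLeRight K (xl s₀)
  · simp only [hop, true_and, not_true_eq_false, false_and, or_false]
    have hθe : angleMinus ω s₀ - 3 * π / 2 = θ := by
      refine huniq _ ⟨by linarith [pi_pos], le_rfl⟩ ?_
      rw [sub_add_cancel, D.H_left, neg_zero]
      refine le_antisymm (D.nonneg _) ?_
      have h1 := hx.inner_tvec_angleMinus_nonpos hK hop
        (hx.mem hK (sLeft ω (angleMinus ω s₀ - 3 * π / 2)))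
      have e : nvec (angleMinus ω s₀ - 3 * π / 2) = tvec (angleMinus ω s₀) := by
        rw [← nvec_add_pi_div_two, ← nvec_add_two_pi]
        congr 1; ring
      rwa [supportFun, e]
    rw [hθe]
  · simp only [hop, false_and, not_false_eq_true, true_and, false_or]
    constructor
    · rintro ⟨h1, h2, h3⟩
      exact huniq ϑ ⟨h1, h2⟩ h3
    · rintro rfl
      exact ⟨hθ.1, hθ.2, heq⟩

end IsCcwArcLengthParam

theorem mainTheorem5 (K : Set Plane) (hcompact : IsCompact K) (hconvex : Convex ℝ K)
    (hnontrivial : K.Nontrivial)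
    (L : ℝ) (xl : ℝ → Plane) (ω : ℝ → ℝ) (hxl : IsCcwArcLengthParam K L xl ω)
    (s₀ : ℝ) (x₀ : Plane) (hx₀ : xl s₀ = x₀)
    (hend : ∀ y : Plane, K ≠ segment ℝ x₀ y) :
    ∃ θl θr : ℝ,
      (∀ ϑ : ℝ, IsThetaStarLeft K xl ω s₀ ϑ ↔ ϑ = θl) ∧
      (∀ ϑ : ℝ, IsThetaStarRight K xl ω s₀ ϑ ↔ ϑ = θr) ∧
      ∃ y : Plane,
        ((leftInvolute xl ω s₀ '' Icc (anglePlus ω s₀) (anglePlus ω s₀ + 2 * π)) ∩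
          (rightInvolute xl ω s₀ '' Icc (angleMinus ω s₀ - 2 * π) (angleMinus ω s₀))) \ {x₀}
            = {y} ∧
        ∃ ϑl ∈ Icc (anglePlus ω s₀) (anglePlus ω s₀ + 2 * π),
        ∃ ϑr ∈ Icc (angleMinus ω s₀ - 2 * π) (angleMinus ω s₀),
          y = leftInvolute xl ω s₀ ϑl ∧ y = rightInvolute xl ω s₀ ϑr ∧
          (θr + 2 * π < ϑl ∧ ϑr < θl - 2 * π) ∧
          (angleMinus ω s₀ ≤ θr + 2 * π ∧
            θr + 2 * π < ϑr + 2 * π ∧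
            ϑr + 2 * π < anglePlus ω s₀ + 3 * π / 2 ∧
            anglePlus ω s₀ + 3 * π / 2 ≤ θl) ∧
          (θr ≤ angleMinus ω s₀ - 3 * π / 2 ∧
            angleMinus ω s₀ - 3 * π / 2 < ϑl - 2 * π ∧
            ϑl - 2 * π < θl - 2 * π ∧
            θl - 2 * π ≤ anglePlus ω s₀) := by
  subst hx₀
  have hπ := pi_pos
  have D := hxl.supportData hcompact hconvex hend
  set h := supportFun xl ω s₀ with hh
  set H := supportPrimitive xl ω s₀ with hH
  set a := angleMinus ω s₀ with ha
  set b := anglePlus ω s₀ with hb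
  have I_eq_zero : ∀ x, H x = 0 → h x = 0 → leftInvolute xl ω s₀ x = xl s₀ := by
    intro x h1 h2
    have := IsCcwArcLengthParam.leftInvolute_sub xl ω s₀ x
    rwa [← hh, ← hH, h1, h2, zero_smul, zero_smul, sub_zero, sub_eq_zero] at this
  have I_ne : ∀ x < a, leftInvolute xl ω s₀ x ≠ xl s₀ := by
    intro x hx1 heq
    have h1 := IsCcwArcLengthParam.gap_eq_inner xl ω s₀ x x
    rw [gap_self, heq, sub_self, inner_zero_right, add_zero] at h1
    linarith [D.primitive_neg hx1]
  obtain ⟨ψ, hψ, φ, hφ, h0, hg⟩ := D.exists_meet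
  obtain ⟨θr, hθr, hθr_eq, hθr_uniq⟩ := D.existsUnique_thetaStar
  obtain ⟨θl', hθl', hθl_eq, hθl_uniq⟩ := D.reflect.existsUnique_thetaStar
  obtain ⟨hψ_lt, hψ_gt⟩ := D.meet_bounds hψ.2 hφ h0 hg
  have hψθ := hψ_gt θr hθr hθr_eq
  have hmeet : leftInvolute xl ω s₀ φ = leftInvolute xl ω s₀ ψ :=
    (IsCcwArcLengthParam.leftInvolute_eq_iff xl ω s₀ φ ψ).2 ⟨h0, hg⟩
  have hbφ : b < φ := by
    by_contra hcon
    push Not at hcon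
    have hφa : φ ∈ Icc a b := ⟨by linarith [hφ.1, hψ.1], hcon⟩
    exact I_ne ψ hψ.2 (hmeet ▸ I_eq_zero φ (D.primitive_eq_zero φ hφa) (D.eq_zero φ hφa))
  -- the estimates for `φ` are those for `ψ`, applied to the reflected body
  obtain ⟨h0', hg'⟩ := SupportData.meet_reflect h0 hg
  obtain ⟨hφ_gt, hφ_lt⟩ := D.reflect.meet_bounds (φ := -ψ) (ψ := -φ) (by linarith)
    ⟨by linarith [hφ.1], by linarith [hφ.2]⟩ h0' hg'
  have hφθ := hφ_lt θl' hθl' hθl_eq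
  have hφ2 : φ ∈ Icc b (b + 2 * π) := ⟨hbφ.le, by linarith [hθl'.1]⟩
  have hψ2 : ψ ∈ Icc (a - 2 * π) a := ⟨hψ.1.le, hψ.2.le⟩
  refine ⟨-θl', θr, ?_, ?_, leftInvolute xl ω s₀ ψ, ?_, φ, hφ2, ψ, hψ2, hmeet.symm,
    (hxl.rightInvolute_eq s₀ ψ).symm, ⟨?_, ?_⟩, ⟨?_, ?_, ?_, ?_⟩, ⟨?_, ?_, ?_, ?_⟩⟩
  · refine hxl.isThetaStarLeft_iff hcompact D ⟨by linarith [hθl'.2], by linarith [hθl'.1]⟩ ?_ ?_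
    · rw [neg_neg] at hθl_eq
      rw [← hh, ← hH, ← hθl_eq]
      congr 1; ring
    · intro ϑ hϑ heq
      have := hθl_uniq (-ϑ) ⟨by linarith [hϑ.2], by linarith [hϑ.1]⟩ (by
        rw [neg_neg, neg_neg]
        refine Eq.trans ?_ heq
        congr 1; ring)
      linarith
  · exact hxl.isThetaStarRight_iff hcompact D hθr hθr_eq hθr_uniq
  · ext z
    simp only [mem_sdiff, mem_inter_iff, mem_singleton_iff]
    constructor
    · rintro ⟨⟨⟨φ', hφ', rfl⟩, ψ', hψ', heq⟩, hne⟩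
      rw [hxl.rightInvolute_eq] at heq
      have hψa : ψ' < a := by
        refine lt_of_le_of_ne hψ'.2 fun hcon => hne ?_
        rw [← heq, hcon]
        exact I_eq_zero a D.H_left D.h_left
      obtain ⟨m0, mg⟩ := (IsCcwArcLengthParam.leftInvolute_eq_iff xl ω s₀ φ' ψ').1 heq.symm
      have e1 := D.minGap_eq_neg_length hψ'.1 hψa hφ'.1 m0 mg
      have e2 := D.minGap_eq_neg_length hψ.1.le hψ.2 hbφ.le h0 hg
      rw [← heq, D.strictMonoOn_minGap.injOn hψa hψ.2 (e1.trans e2.symm)]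
    · rintro rfl
      exact ⟨⟨⟨φ, hφ2, hmeet⟩, ψ, hψ2, hxl.rightInvolute_eq s₀ ψ⟩, I_ne ψ hψ.2⟩
  all_goals linarith [hθr.1, hθr.2, hθl'.1, hθl'.2]
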